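/- Let $n\ge 1$, let $X\subseteq\mathbb R^n$ be nonempty, closed and convex, let $L_0>0$, and consider $\min_{x\in X} f(x)$, where $f:\mathbb R^n\to\mathbb R$ and a sampled function $G(\cdot,s)$, with $s$ random, are given in one of the following three settings. (All functions and random fields are jointly measurable.) (a) Standard setting: $s=\xi$ is a random vector in $\mathbb R^d$ and $G=F$. Here $f(x)=\mathbb E_\xi[F(x,\xi)]$ exists for all $x$, $\|F(x,\cdot)-F(y,\cdot)\|_{L^2(\xi)}\le L_0\|x-y\|$ for all $x,y\in\mathbb R^n$, and $F(\cdot,\xi)$ is convex on $\mathbb R^n$ for almost every $\xi$. (b) Decision-dependent setting with known densities: $f(x)=\int \hat F(x,\xi)\,p(\xi\mid x)\,d\xi$ is convex on $\mathbb R^n$, where $p(\cdot\mid x)$ is a probability density on $\mathbb R^d$ with $\Xi(x)=\{\xi: p(\xi\mid x)>0\}$. There is a probability density $\tilde p$ on $\mathbb R^d$ such that $\tilde p(\xi)>0$ and $p(\xi\mid x)/\tilde p(\xi)\le M$ for all $x$ and $\xi\in\Xi(x)$. The symmetric Kullback–Leibler divergence of $p(\cdot\mid x)$ and $p(\cdot\mid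 y)$ is at most $L_\xi^2\|x-y\|^2$, $\|\hat F(x,\cdot)-\hat F(y,\cdot)\|_{L^2(\xi\sim\tilde p)}\le \hat L_f\|x-y\|$, and for every $x$, $|\hat F(x,\xi)|\le M_f$ for a.e. $\xi\in\Xi(x)$. Put $L_0=\sqrt{2(M^2\hat L_f^2+MM_f^2L_\xi^2)}$. Here $s=\xi\sim\tilde p$ and $G(x,\xi)=\hat F(x,\xi)\,p(\xi\mid x)/\tilde p(\xi)$. (c) Decision-dependent setting with unknown densities: $f(x)=\mathbb E_{\xi\sim\mathcal D(x)}[\hat F(x,\xi)]$ exists for all $x$ and is convex on $\mathbb R^n$. There is a random field $(\xi_x)_{x\in\mathbb R^n}$ with $\xi_x\sim\mathcal D(x)$ and $\|\hat F(x,\xi_x)-\hat F(y,\xi_y)\|_{L^2}\le L_0\|x-y\|$ for all $x,y$. Here $s$ is a realization of the field and $G(x,s)=\hat F(x,\xi_x)$. For $\eta>0$ let $\tilde g_\eta(x,v,z,s)\in\mathbb R^n$ have the components $$\tilde g^i_\eta(x,v,z,s)=\tfrac1{\eta\sqrt{2\pi}}\Big[G\big(x_i+\eta\sqrt{2v},\,x^{-i}-z^{-i},\,s\big)-G\big(x_i-\eta\sqrt{2v},\,x^{-i}-z^{-i},\,s\big)\Big],\qquad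 i=1,\dots,n,$$ where $(x_i\pm t,\,x^{-i}-z^{-i})$ is the point with $i$-th coordinate $x_i\pm t$ and $j$-th coordinate $x_j-z_j$ for $j\neq i$. Given a deterministic $x_0\in X$ and step sizes $\gamma_k>0$, let $$x_{k+1}=\Pi_X\big[x_k-\gamma_k\,\tilde g_\eta(x_k,V_k,Z_k,s_k)\big],\qquad k\ge 0,$$ where $\Pi_X$ is the Euclidean projection onto $X$, the triples $(V_k,Z_k,s_k)$ are i.i.d., and $V_k\sim\mathrm{Exp}(1)$, $Z_k\sim\mathcal N_n(0,\eta^2I)$ and $s_k$ (distributed as $s$) are independent. Put $S_K=\sum_{k=0}^{K-1}\gamma_k$ and $\bar x_K=S_K^{-1}\sum_{k=0}^{K-1}\gamma_kx_k$. Suppose that $f$ has a minimizer over $X$, let $x^*$ be one, and let $a_0=\|x_0-x^*\|$. (i) For every $K\ge 1$, $f(\bar x_K)$ and all $f(x_k)$ are integrable, and $$\mathbb E[f(\bar x_K)]-f(x^*)\le\frac1{S_K}\sum_{k=0}^{K-1}\mathbb E\big[\gamma_k(f(x_k)-f(x^*))\big]\le L_0\sqrt{n+1}\,\eta+\frac1{S_K}\Big[\frac{a_0^2}{2}+\frac{2L_0^2n}{\pi}\sum_{k=0}^{K-1}\gamma_k^2\Big].$$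 (ii) Let $R>0$ and, for a given $K\ge1$, run the method with $\gamma_k=\frac{R}{L_0\sqrt{nK}}$ and $\eta=\frac1{\sqrt{nK}}$. Then the number of iterations and the number of function evaluations (evaluations of $G(\cdot,s_k)$ at a point) required for $\mathbb E[f(\bar x_K)]-f(x^*)\le\varepsilon$ are $\mathcal O(n\varepsilon^{-2})$ and $\mathcal O(n^2\varepsilon^{-2})$. Precisely, there is a constant $C>0$, depending only on $L_0$, $R$ and an upper bound for $a_0$ (not on $n$, $\varepsilon$ or the problem), such that: for every $\varepsilon>0$ the bound $\mathbb E[f(\bar x_K)]-f(x^*)\le\varepsilon$ holds for every $K\ge1$ with $K\ge Cn\varepsilon^{-2}$; and for every $\varepsilon\in(0,1]$ it holds for some $K\ge 1$ with $K\le Cn\varepsilon^{-2}$ for which the $K$ iterations make at most $Cn^2\varepsilon^{-2}$ function evaluations. -/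

import Mathlib

open MeasureTheory ProbabilityTheory

universe u

noncomputable section

/-- The Euclidean space `ℝⁿ`. -/
abbrev Euc (n : ℕ) : Type := EuclideanSpace ℝ (Fin n)

/-! ### Computations that count function evaluations -/

/-- A value together with the number of function evaluations made to obtain it. -/
structure Counted (α : Type*) where
  val : α
  evals : ℕ

namespace Counted

/-- A value that needs no function evaluation. -/
def pure {α : Type*} (a : α) : Counted α := ⟨a, 0⟩

/-- Sequential composition: the numbers of evaluations add up. -/
def bind {α β : Type*} (c : Counted α) (k : α → Counted β) : Counted β :=
  ⟨(k c.val).val, c.evals + (k c.val).evals⟩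

/-- Computing the `n` coordinates of a vector one after the other. -/
def vec {n : ℕ} (c : Fin n → Counted ℝ) : Counted (Euc n) :=
  ⟨WithLp.toLp 2 fun i => (c i).val, ∑ i, (c i).evals⟩

end Counted

/-! ### Stochastic optimization problems -/

/-- The objective `obj` of a stochastic optimization problem over `ℝⁿ`, together with the random
function through which it is accessed: drawing `s ∈ S` with distribution `law` fixes the
realization `x ↦ sample x s`, which can then be evaluated at any points. -/
structure StochModel (n : ℕ) where
  S : Type
  [mS : MeasurableSpace S]
  law : Measure S
  sample : Euc n → S → ℝ
  obj : Euc n → ℝ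

attribute [instance] StochModel.mS

/-- The standard (decision-independent) problem: `ξ ∼ μ`, `f x = 𝔼[F (x, ξ)]`. -/
def standardModel {n d : ℕ} (F : Euc n → Euc d → ℝ) (μ : Measure (Euc d)) : StochModel n where
  S := Euc d
  law := μ
  sample := F
  obj := fun x => ∫ ξ, F x ξ ∂μ

/-- Assumptions in the standard setting: `F` is jointly measurable, the expectation defining `f`
exists, `F` is `L₀`-Lipschitz in the `L²(ξ)` norm, and `F (·, ξ)` is convex. -/
structure StandardAssumptions {n d : ℕ} (L₀ : ℝ) (F : Euc n → Euc d → ℝ)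
    (μ : Measure (Euc d)) : Prop where
  prob : IsProbabilityMeasure μ
  meas : Measurable (Function.uncurry F)
  integrable : ∀ x, Integrable (F x) μ
  lipschitz : ∀ x y, eLpNorm (fun ξ => F x ξ - F y ξ) 2 μ ≤ ENNReal.ofReal (L₀ * ‖x - y‖)
  convex : ∀ᵐ ξ ∂μ, ConvexOn ℝ Set.univ (fun x => F x ξ)

/-- The measure on `ℝᵈ` with Lebesgue density `q`. -/
def densityMeasure {d : ℕ} (q : Euc d → ℝ) : Measure (Euc d) :=
  volume.withDensity fun ξ => ENNReal.ofReal (q ξ)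

/-- The decision-dependent problem with known conditional density `p (ξ | x)`, written here
`p x ξ`: `f x = ∫ F̂ (x, ξ) p (ξ | x) dξ`. One samples `ξ` from the density `q` (`p̃` in the usual
notation) and evaluates `F̃ (x, ξ) = F̂ (x, ξ) p (ξ | x) / q ξ`. -/
def knownDensityModel {n d : ℕ} (F : Euc n → Euc d → ℝ) (p : Euc n → Euc d → ℝ)
    (q : Euc d → ℝ) : StochModel n where
  S := Euc d
  law := densityMeasure q
  sample := fun x ξ => F x ξ * (p x ξ / q ξ)
  obj := fun x => ∫ ξ, F x ξ * p x ξ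

/-- Assumptions in the decision-dependent setting with known density. The set `Ξ(x)` of possible
outcomes at the decision `x` is `{ξ | 0 < p x ξ}`. The sum of the two Kullback-Leibler divergences
(which is infinite unless the two distributions are mutually absolutely continuous) is the
symmetric Kullback-Leibler divergence. -/
structure KnownDensityAssumptions {n d : ℕ} (Lξ M Lf Mf : ℝ) (F : Euc n → Euc d → ℝ)
    (p : Euc n → Euc d → ℝ) (q : Euc d → ℝ) : Prop where
  meas_F : Measurable (Function.uncurry F)
  meas_p : Measurable (Function.uncurry p)
  meas_q : Measurable q
  nonneg_p : ∀ x ξ, 0 ≤ p x ξ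
  nonneg_q : ∀ ξ, 0 ≤ q ξ
  prob_p : ∀ x, IsProbabilityMeasure (densityMeasure (p x))
  prob_q : IsProbabilityMeasure (densityMeasure q)
  kl_le : ∀ x y,
    InformationTheory.klDiv (densityMeasure (p x)) (densityMeasure (p y)) +
      InformationTheory.klDiv (densityMeasure (p y)) (densityMeasure (p x)) ≤
        ENNReal.ofReal (Lξ ^ 2 * ‖x - y‖ ^ 2)
  ratio_le : ∀ x ξ, 0 < p x ξ → 0 < q ξ ∧ p x ξ / q ξ ≤ M
  lipschitz : ∀ x y, eLpNorm (fun ξ => F x ξ - F y ξ) 2 (densityMeasure q) ≤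
    ENNReal.ofReal (Lf * ‖x - y‖)
  bounded : ∀ x, ∀ᵐ ξ, 0 < p x ξ → |F x ξ| ≤ Mf
  convex : ConvexOn ℝ Set.univ (fun x => ∫ ξ, F x ξ * p x ξ)

/-- The decision-dependent problem with unknown density: `f x = 𝔼_{ξ ∼ 𝒟(x)}[F̂ (x, ξ)]`. The
oracle draws a realization `s ∼ ρ` of the random field `(ξ_x)_x` and returns `F̂ (x, ξ_x)` for the
requested points `x`. -/
def randomFieldModel {n d : ℕ} {S : Type} [MeasurableSpace S] (F : Euc n → Euc d → ℝ)
    (𝒟 : Euc n → Measure (Euc d)) (ρ : Measure S) (field : Euc n → S → Euc d) :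
    StochModel n where
  S := S
  law := ρ
  sample := fun x s => F x (field x s)
  obj := fun x => ∫ ξ, F x ξ ∂(𝒟 x)

/-- Assumptions in the decision-dependent setting with unknown density: the random field has the
marginals `𝒟 x`, and `F̂ (x, ξ_x)` is `L₀`-Lipschitz in `x` in the `L²` norm. -/
structure RandomFieldAssumptions {n d : ℕ} {S : Type} [MeasurableSpace S] (L₀ : ℝ)
    (F : Euc n → Euc d → ℝ) (𝒟 : Euc n → Measure (Euc d)) (ρ : Measure S)
    (field : Euc n → S → Euc d) : Prop where
  prob : IsProbabilityMeasure ρ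
  meas_F : Measurable (Function.uncurry F)
  meas_field : Measurable (Function.uncurry field)
  marginal : ∀ x, ρ.map (field x) = 𝒟 x
  integrable : ∀ x, Integrable (F x) (𝒟 x)
  lipschitz : ∀ x y, eLpNorm (fun s => F x (field x s) - F y (field y s)) 2 ρ ≤
    ENNReal.ofReal (L₀ * ‖x - y‖)
  convex : ConvexOn ℝ Set.univ (fun x => ∫ ξ, F x ξ ∂(𝒟 x))

/-- The three settings, each with its Lipschitz constant `L₀`. -/
inductive Admissible {n : ℕ} (L₀ : ℝ) : StochModel n → Prop
  | standard {d : ℕ} (F : Euc n → Euc d → ℝ) (μ : Measure (Euc d))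
      (h : StandardAssumptions L₀ F μ) : Admissible L₀ (standardModel F μ)
  | knownDensity {d : ℕ} (Lξ M Lf Mf : ℝ) (F : Euc n → Euc d → ℝ) (p : Euc n → Euc d → ℝ)
      (q : Euc d → ℝ) (h : KnownDensityAssumptions Lξ M Lf Mf F p q)
      (hL : L₀ = √(2 * (M ^ 2 * Lf ^ 2 + M * Mf ^ 2 * Lξ ^ 2))) :
      Admissible L₀ (knownDensityModel F p q)
  | randomField {d : ℕ} {S : Type} [MeasurableSpace S] (F : Euc n → Euc d → ℝ)
      (𝒟 : Euc n → Measure (Euc d)) (ρ : Measure S) (field : Euc n → S → Euc d)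
      (h : RandomFieldAssumptions L₀ F 𝒟 ρ field) :
      Admissible L₀ (randomFieldModel F 𝒟 ρ field)

/-! ### The algorithm -/

/-- A Euclidean projection of `u` onto `X` (unique when `X` is nonempty, closed and convex). -/
def eucProj {n : ℕ} (X : Set (Euc n)) (u : Euc n) : Euc n :=
  Classical.epsilon fun p => p ∈ X ∧ ∀ y ∈ X, ‖u - p‖ ≤ ‖u - y‖

/-- The point `(x_i + t, x^{-i} - z^{-i})`. -/
def shifted {n : ℕ} (i : Fin n) (t : ℝ) (x z : Euc n) : Euc n :=
  WithLp.toLp 2 fun j => if j = i then x j + t else x j - z j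

namespace StochModel

variable {n : ℕ} (P : StochModel n)

/-- One evaluation of the sampled function. -/
def query (s : P.S) (y : Euc n) : Counted ℝ := ⟨P.sample y s, 1⟩

/-- The exponentially-shifted Gaussian smoothing gradient estimator: its `i`-th component is
`(1 / (η √(2π))) (G (x_i + η √(2v), x^{-i} - z^{-i}) - G (x_i - η √(2v), x^{-i} - z^{-i}))`, where
`G` is the sampled function. -/
def esGs (η : ℝ) (x : Euc n) (v : ℝ) (z : Euc n) (s : P.S) : Counted (Euc n) :=
  Counted.vec fun i =>
    (P.query s (shifted i (η * √(2 * v)) x z)).bind fun a =>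
      (P.query s (shifted i (-(η * √(2 * v))) x z)).bind fun b =>
        Counted.pure (1 / (η * √(2 * Real.pi)) * (a - b))

/-- The first `k` iterations of `x_{k+1} = Π_X (x_k - γ_k g̃_η (x_k, v_k, z_k, s_k))` from `x₀`,
for given realizations of the random variables. -/
def run (X : Set (Euc n)) (x₀ : Euc n) (γ : ℕ → ℝ) (η : ℝ)
    (v : ℕ → ℝ) (z : ℕ → Euc n) (s : ℕ → P.S) : ℕ → Counted (Euc n)
  | 0 => Counted.pure x₀
  | k + 1 => (run X x₀ γ η v z s k).bind fun x =>
      (P.esGs η x (v k) (z k) (s k)).bind fun g =>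
        Counted.pure (eucProj X (x - γ k • g))

/-- The iterate `x_k`, as a function of the outcome. -/
def iterate {Ω : Type*} (X : Set (Euc n)) (x₀ : Euc n) (γ : ℕ → ℝ) (η : ℝ)
    (V : ℕ → Ω → ℝ) (Z : ℕ → Ω → Euc n) (s : ℕ → Ω → P.S) (k : ℕ) (ω : Ω) : Euc n :=
  (P.run X x₀ γ η (V · ω) (Z · ω) (s · ω) k).val

/-- The number of function evaluations made in the first `k` iterations. -/
def evalCount {Ω : Type*} (X : Set (Euc n)) (x₀ : Euc n) (γ : ℕ → ℝ) (η : ℝ)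
    (V : ℕ → Ω → ℝ) (Z : ℕ → Ω → Euc n) (s : ℕ → Ω → P.S) (k : ℕ) (ω : Ω) : ℕ :=
  (P.run X x₀ γ η (V · ω) (Z · ω) (s · ω) k).evals

/-- The weighted average `x̄_K = (∑_{k < K} γ_k x_k) / (∑_{k < K} γ_k)`. -/
def average {Ω : Type*} (X : Set (Euc n)) (x₀ : Euc n) (γ : ℕ → ℝ) (η : ℝ)
    (V : ℕ → Ω → ℝ) (Z : ℕ → Ω → Euc n) (s : ℕ → Ω → P.S) (K : ℕ) (ω : Ω) : Euc n :=
  (∑ k ∈ Finset.range K, γ k)⁻¹ •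
    ∑ k ∈ Finset.range K, γ k • P.iterate X x₀ γ η V Z s k ω

/-- The random variables driving the algorithm: `(V_k, Z_k, s_k)`, `k = 0, 1, 2, …`, are i.i.d.,
and for each `k` the variables `V_k ∼ Exp(1)`, `Z_k ∼ 𝒩(0, η² I)` and `s_k ∼ law` are
independent. -/
structure IsSampling (η : ℝ) {Ω : Type*} [MeasurableSpace Ω] (μ : Measure Ω)
    (V : ℕ → Ω → ℝ) (Z : ℕ → Ω → Euc n) (s : ℕ → Ω → P.S) : Prop where
  meas_V : ∀ k, Measurable (V k)
  meas_Z : ∀ k, Measurable (Z k)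
  meas_s : ∀ k, Measurable (s k)
  law_eq : ∀ k, μ.map (fun ω => (V k ω, Z k ω, s k ω)) =
    (expMeasure 1).prod
      (((Measure.pi fun _ : Fin n => gaussianReal 0 (Real.toNNReal (η ^ 2))).map
        (WithLp.toLp 2)).prod P.law)
  indep : iIndepFun (fun k ω => (V k ω, Z k ω, s k ω)) μ

end StochModel

end

open scoped ENNReal NNReal

/-! Each of the three settings supplies an unbiased sampled function that is `L₀`-Lipschitz in `L²`,
together with a convex objective; `StochModel.IsRegular` records this, and nothing else about the
settings is used afterwards. Only known densities need work: the difference of `F̂ p/p̃` at two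
points is split into a change of `F̂` and a change of density, and the latter is controlled by the
symmetric Kullback–Leibler divergence.

The estimator works because `T = η√(2v)` has tail `P(T > |t|) = exp(-t²/(2η²))`, which is `η√(2π)`
times the Gaussian density. Writing `h(T) - h(-T)` as the integral of `h'` over `(-T, T)` and
applying Fubini, the normalized difference has mean `𝔼 h'(N)` with `N ∼ 𝒩(0, η²)`. With the other
coordinates shifted by `-Z`, the mean estimator is the gradient of the Gaussian smoothing of `f`
(`LipschitzWith.integral_esGs`). Convexity makes it an approximate subgradient of `f` with error
`L₀√n η`. Its second moment is at most `4nL₀²/π` whatever `η` is, since the two sample points are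
`2η√(2v)` apart and `𝔼 v = 1`.

The rest is the projected subgradient argument: `x_k` is independent of the `k`-th draw, the
projection is nonexpansive, and the squared distances to `x*` telescope (`IsRegular.step`,
`IsRegular.sum_mul_integral_le`). For (ii), the bound becomes `B√(n/K)` with `B` free of `n`, and
each iteration costs `2n` evaluations. -/

/-! ### Exponential law and the one-dimensional smoothing identity -/

theorem expMeasure_real_Ioi {a : ℝ} (ha : 0 ≤ a) :
    (expMeasure 1).real (Set.Ioi a) = Real.exp (-a) := by
  have := isProbabilityMeasure_expMeasure one_pos
  have h1 := cdf_expMeasure_eq one_pos a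
  rw [cdf_eq_real, if_pos ha, one_mul] at h1
  rw [← Set.compl_Iic, probReal_compl_eq_one_sub measurableSet_Iic, h1]
  ring

theorem expMeasure_Ioi {a : ℝ} (ha : 0 ≤ a) :
    expMeasure 1 (Set.Ioi a) = ENNReal.ofReal (Real.exp (-a)) := by
  have := isProbabilityMeasure_expMeasure one_pos
  rw [← expMeasure_real_Ioi ha, ofReal_measureReal]

theorem ae_nonneg_expMeasure : ∀ᵐ v ∂expMeasure 1, 0 ≤ v := by
  have := isProbabilityMeasure_expMeasure one_pos
  have h1 := cdf_expMeasure_eq one_pos 0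
  rw [cdf_eq_real, if_pos le_rfl] at h1
  simp only [mul_zero, neg_zero, Real.exp_zero, sub_self] at h1
  have h2 : expMeasure 1 (Set.Iic 0) = 0 := by
    rwa [measureReal_eq_zero_iff] at h1
  rw [ae_iff]
  exact measure_mono_null (fun v hv => (not_le.mp hv).le) h2

/-- Layer-cake formula applied to the tail `exp(-t)`. This is the `𝔼 v = 1` that fixes the constant
in the second-moment bound. -/
theorem lintegral_ofReal_expMeasure : ∫⁻ v, ENNReal.ofReal v ∂expMeasure 1 = 1 := by
  rw [lintegral_eq_lintegral_meas_lt _ ae_nonneg_expMeasure measurable_id.aemeasurable]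
  have h : ∀ t ∈ Set.Ioi (0 : ℝ), expMeasure 1 {v | t < v} = ENNReal.ofReal (Real.exp (-t)) :=
    fun t ht => expMeasure_Ioi (le_of_lt ht)
  rw [setLIntegral_congr_fun measurableSet_Ioi h,
    ← ofReal_integral_eq_lintegral_ofReal]
  · rw [integral_exp_neg_Ioi_zero, ENNReal.ofReal_one]
  · have := exp_neg_integrableOn_Ioi 0 one_pos
    simpa only [neg_one_mul] using this.integrable
  · exact .of_forall fun t => (Real.exp_pos _).le

theorem integrable_id_expMeasure : Integrable (fun v : ℝ => v) (expMeasure 1) := by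
  refine ⟨by fun_prop, ?_⟩
  rw [hasFiniteIntegral_iff_ofReal ae_nonneg_expMeasure, lintegral_ofReal_expMeasure]
  exact ENNReal.one_lt_top

theorem integrable_sqrt_expMeasure : Integrable (fun v : ℝ => √(2 * v)) (expMeasure 1) := by
  have := isProbabilityMeasure_expMeasure one_pos
  refine ((integrable_id_expMeasure.norm.const_mul 2).add (integrable_const (1 : ℝ))).mono'
    (by fun_prop) (.of_forall fun v => ?_)
  rw [Real.norm_of_nonneg (Real.sqrt_nonneg _)]
  simp only [Pi.add_apply, Real.norm_eq_abs]
  refine Real.sqrt_le_iff.mpr ⟨by positivity, ?_⟩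
  nlinarith [le_abs_self v, abs_nonneg v]

/-- A Lipschitz function is absolutely continuous, so the fundamental theorem of calculus holds
although `deriv h` takes its default value `0` at points of non-differentiability. -/
theorem LipschitzWith.integral_deriv_Ioo {h : ℝ → ℝ} {C : ℝ≥0} (hh : LipschitzWith C h) {T : ℝ}
    (hT : 0 ≤ T) : ∫ t, (Set.Ioo (-T) T).indicator (deriv h) t = h T - h (-T) := by
  rw [integral_indicator measurableSet_Ioo, ← integral_Ioc_eq_integral_Ioo,
    ← intervalIntegral.integral_of_le (by linarith)]
  exact hh.lipschitzOnWith.absolutelyContinuousOnInterval.integral_deriv_eq_sub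

theorem mem_Ioo_neg_mul_sqrt_iff {η : ℝ} (hη : 0 < η) (t v : ℝ) :
    t ∈ Set.Ioo (-(η * √(2 * v))) (η * √(2 * v)) ↔ v ∈ Set.Ioi (t ^ 2 / (2 * η ^ 2)) := by
  rw [Set.mem_Ioo, ← abs_lt, Set.mem_Ioi, div_lt_iff₀ (by positivity), ← div_lt_iff₀' hη,
    Real.lt_sqrt (by positivity), div_pow, sq_abs, div_lt_iff₀ (by positivity)]
  constructor <;> intro h <;> linarith

/-- The uniform distribution on `[-T, T]` weighted by the Rayleigh variable `T = η √(2v)`,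
`v ∼ Exp(1)`, is Gaussian. -/
theorem LipschitzWith.integral_expMeasure_sub {h : ℝ → ℝ} {C : ℝ≥0} (hh : LipschitzWith C h)
    {η : ℝ} (hη : 0 < η) :
    ∫ v, 1 / (η * √(2 * Real.pi)) * (h (η * √(2 * v)) - h (-(η * √(2 * v)))) ∂expMeasure 1 =
      ∫ t, deriv h t ∂gaussianReal 0 (Real.toNNReal (η ^ 2)) := by
  have := isProbabilityMeasure_expMeasure one_pos
  -- The derivative cut off to `|t| < η√(2v)`; for fixed `t` this is a tail condition on `v`, which
  -- makes the inner integral after Fubini an exponential tail.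
  set A : ℝ → ℝ → ℝ := fun v t =>
    (Set.Ioo (-(η * √(2 * v))) (η * √(2 * v))).indicator (deriv h) t with hA
  have hA' : ∀ v t, A v t = (Set.Ioi (t ^ 2 / (2 * η ^ 2))).indicator (fun _ => deriv h t) v := by
    intro v t
    simp only [hA, Set.indicator_apply, mem_Ioo_neg_mul_sqrt_iff hη]
  have hmeas : Measurable (Function.uncurry A) := by
    have : Function.uncurry A = {q : ℝ × ℝ | q.2 ^ 2 / (2 * η ^ 2) < q.1}.indicator
        (fun q => deriv h q.2) := by
      ext q
      simp only [Function.uncurry, hA', Set.indicator_apply, Set.mem_Ioi, Set.mem_ofPred_eq]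
    rw [this]
    exact ((measurable_deriv h).comp measurable_snd).indicator
      (measurableSet_lt (by fun_prop) (by fun_prop))
  -- Fubini applies because the inner integral of `|A v ·|` is at most `2Cη√(2v)`, which is
  -- integrable in `v`.
  have hint : Integrable (Function.uncurry A) ((expMeasure 1).prod volume) := by
    refine (integrable_prod_iff hmeas.aestronglyMeasurable).mpr ⟨.of_forall fun v => ?_, ?_⟩
    · change Integrable ((Set.Ioo (-(η * √(2 * v))) (η * √(2 * v))).indicator (deriv h)) volume
      refine IntegrableOn.integrable_indicator ?_ measurableSet_Ioo
      exact Measure.integrableOn_of_bounded (by simp) (measurable_deriv h).aestronglyMeasurable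
        (M := C) (.of_forall fun t => norm_deriv_le_of_lipschitz hh)
    · refine ((integrable_sqrt_expMeasure.const_mul (2 * η * C))).mono'
        (hmeas.norm.stronglyMeasurable.integral_prod_right'.aestronglyMeasurable)
        (.of_forall fun v => ?_)
      have h0 : 0 ≤ η * √(2 * v) := by positivity
      rw [Real.norm_of_nonneg (integral_nonneg fun _ => norm_nonneg _)]
      have : ∀ t, ‖Function.uncurry A (v, t)‖ =
          (Set.Ioo (-(η * √(2 * v))) (η * √(2 * v))).indicator (fun t => ‖deriv h t‖) t :=
        fun t => norm_indicator_eq_indicator_norm _ _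
      simp_rw [this]
      rw [integral_indicator measurableSet_Ioo]
      refine (Real.le_norm_self _).trans ((norm_setIntegral_le_of_norm_le_const (C := C) (by simp)
        fun t _ => by simpa using norm_deriv_le_of_lipschitz hh).trans_eq ?_)
      rw [Real.volume_real_Ioo_of_le (by linarith)]
      ring
  calc ∫ v, 1 / (η * √(2 * Real.pi)) * (h (η * √(2 * v)) - h (-(η * √(2 * v)))) ∂expMeasure 1
      = 1 / (η * √(2 * Real.pi)) * ∫ v, (∫ t, A v t) ∂expMeasure 1 := by
        rw [integral_const_mul]
        congr 2
        ext v
        exact (hh.integral_deriv_Ioo (by positivity)).symm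
    _ = 1 / (η * √(2 * Real.pi)) * ∫ t, (∫ v, A v t ∂expMeasure 1) := by
        rw [integral_integral_swap hint]
    _ = _ := by
        have hv : (Real.toNNReal (η ^ 2)) ≠ 0 := by
          rw [Ne, Real.toNNReal_eq_zero]; push Not; positivity
        rw [integral_gaussianReal_eq_integral_smul hv, ← integral_const_mul]
        congr 1
        ext t
        simp_rw [hA']
        -- The `v`-integral is `exp(-t²/(2η²)) · deriv h t`; the prefactor `1/(η√(2π))` normalizes
        -- the weight to the Gaussian density.
        rw [integral_indicator measurableSet_Ioi, setIntegral_const,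
          expMeasure_real_Ioi (by positivity), gaussianPDFReal, Real.coe_toNNReal _ (sq_nonneg η),
          smul_eq_mul, smul_eq_mul, Real.sqrt_mul' _ (sq_nonneg η), Real.sqrt_sq hη.le]
        simp only [sub_zero, neg_div]
        field_simp

/-! ### Gaussian measure on Euclidean space -/

/-- The centered Gaussian measure on `ℝⁿ` with covariance `η² I`. -/
noncomputable def gaussianEuc (n : ℕ) (η : ℝ) : Measure (Euc n) :=
  (Measure.pi fun _ : Fin n => gaussianReal 0 (Real.toNNReal (η ^ 2))).map (WithLp.toLp 2)

instance (n : ℕ) (η : ℝ) : IsProbabilityMeasure (gaussianEuc n η) :=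
  Measure.isProbabilityMeasure_map (by fun_prop)

/-- On the line through `p` in direction `w`, the slope of a convex function over `[0, 1]` dominates
its derivative at `0`. -/
theorem ConvexOn.add_fderiv_le {E : Type*} [NormedAddCommGroup E] [NormedSpace ℝ E] {f : E → ℝ}
    (hf : ConvexOn ℝ Set.univ f) {p : E} (hp : DifferentiableAt ℝ f p) (w : E) :
    f p + fderiv ℝ f p w ≤ f (p + w) := by
  have h1 : ConvexOn ℝ Set.univ (fun t : ℝ => f (p + t • w)) := by
    have := hf.comp_affineMap (AffineMap.lineMap p (p + w) : ℝ →ᵃ[ℝ] E)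
    rw [Set.preimage_univ] at this
    refine this.congr fun t _ => ?_
    simp [AffineMap.lineMap_apply, add_comm]
  have h2 : HasDerivAt (fun t : ℝ => f (p + t • w)) (fderiv ℝ f p w) 0 :=
    hp.hasFDerivAt.hasLineDerivAt w
  have h3 := h1.le_slope_of_hasDerivAt (Set.mem_univ 0) (Set.mem_univ 1) one_pos h2
  simp only [slope_def_field, one_smul, zero_smul, add_zero, sub_zero, div_one] at h3
  linarith

theorem MeasureTheory.Measure.AbsolutelyContinuous.pi_fin {n : ℕ} {α : Type*} [MeasurableSpace α]
    {μ ν : Measure α} [SigmaFinite μ] [SigmaFinite ν] (h : μ ≪ ν) :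
    (Measure.pi fun _ : Fin n => μ) ≪ Measure.pi fun _ : Fin n => ν := by
  induction n with
  | zero =>
    rw [Measure.pi_of_empty, Measure.pi_of_empty]
  | succ n ih =>
    have h1 := (measurePreserving_piFinSuccAbove (fun _ : Fin (n + 1) => μ) 0).symm
    have h2 := (measurePreserving_piFinSuccAbove (fun _ : Fin (n + 1) => ν) 0).symm
    rw [← h1.map_eq, ← h2.map_eq]
    exact (h.prod ih).map (MeasurableEquiv.measurable _)

/-- Transfers Rademacher's Lebesgue-a.e. differentiability to the Gaussian measure. -/
theorem gaussianEuc_absolutelyContinuous (n : ℕ) {η : ℝ} (hη : 0 < η) :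
    gaussianEuc n η ≪ (volume : Measure (Euc n)) := by
  have hv : (Real.toNNReal (η ^ 2)) ≠ 0 := by
    rw [Ne, Real.toNNReal_eq_zero]; push Not; positivity
  rw [← (PiLp.volume_preserving_toLp (Fin n)).map_eq]
  exact ((gaussianReal_absolutelyContinuous 0 hv).pi_fin).map (by fun_prop)

theorem measurePreserving_neg_gaussianEuc (n : ℕ) (η : ℝ) :
    MeasurePreserving (fun z : Euc n => -z) (gaussianEuc n η) (gaussianEuc n η) := by
  refine ⟨measurable_neg, ?_⟩
  have h : (Measure.pi fun _ : Fin n => gaussianReal 0 (Real.toNNReal (η ^ 2))).map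
      (fun x i => -(x i)) = Measure.pi fun _ : Fin n => gaussianReal 0 (Real.toNNReal (η ^ 2)) := by
    have : ∀ i : Fin n, SigmaFinite
        ((gaussianReal 0 (Real.toNNReal (η ^ 2))).map (fun x : ℝ => -x)) := fun _ => by
      rw [gaussianReal_map_neg]; infer_instance
    rw [Measure.pi_map_pi (f := fun _ (x : ℝ) => -x) (fun i => by fun_prop)]
    simp only [gaussianReal_map_neg, neg_zero]
  rw [gaussianEuc, Measure.map_map measurable_neg (by fun_prop)]
  conv_rhs => rw [← h, Measure.map_map (by fun_prop) (by fun_prop)]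
  rfl

theorem shifted_eq_add {n : ℕ} (i : Fin n) (t : ℝ) (x z : Euc n) :
    shifted i t x z = x + WithLp.toLp 2 (Function.update (-z).ofLp i t) := by
  ext j
  by_cases h : j = i
  · subst h; simp [shifted]
  · simp [shifted, h, sub_eq_add_neg]

/-- Replacing one coordinate of `-Z`, with `Z` a centered Gaussian vector, by an independent
Gaussian variable does not change the law. -/
theorem measurePreserving_update_gaussianEuc {n : ℕ} (η : ℝ) (i : Fin n) :
    MeasurePreserving (fun q : Euc n × ℝ => WithLp.toLp 2 (Function.update (-q.1).ofLp i q.2))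
      ((gaussianEuc n η).prod (gaussianReal 0 (Real.toNNReal (η ^ 2)))) (gaussianEuc n η) := by
  set γ := gaussianReal 0 (Real.toNNReal (η ^ 2))
  have hm : Measurable (fun q : (Fin n → ℝ) × ℝ => Function.update q.1 i q.2) := by
    refine measurable_pi_lambda _ fun j => ?_
    by_cases h : j = i
    · subst h; simpa using measurable_snd
    · simp only [Function.update_of_ne h]
      exact (measurable_pi_apply j).comp measurable_fst
  have key : MeasurePreserving (fun q : (Fin n → ℝ) × ℝ => Function.update q.1 i q.2)
      ((Measure.pi fun _ : Fin n => γ).prod γ) (Measure.pi fun _ : Fin n => γ) := by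
    -- It suffices to test boxes: the preimage of a box has side `i` freed in the vector, of mass
    -- one, while the scalar carries the constraint `s i`.
    refine ⟨hm, (Measure.pi_eq fun s hs => ?_).symm⟩
    rw [Measure.map_apply hm (MeasurableSet.univ_pi hs)]
    have : (fun q : (Fin n → ℝ) × ℝ => Function.update q.1 i q.2) ⁻¹' Set.univ.pi s =
        (Set.univ.pi (Function.update s i Set.univ)) ×ˢ s i := by
      ext q
      simp only [Set.mem_preimage, Set.mem_univ_pi, Set.mem_prod]
      constructor
      · intro h
        refine ⟨fun j => ?_, by simpa using h i⟩
        by_cases hj : j = i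
        · subst hj; simp
        · simpa [hj] using h j
      · rintro ⟨h, hi⟩ j
        by_cases hj : j = i
        · subst hj; simpa using hi
        · simpa [hj] using h j
    rw [this, Measure.prod_prod, Measure.pi_pi, ← Finset.mul_prod_erase _ _ (Finset.mem_univ i),
      ← Finset.mul_prod_erase Finset.univ (fun j => γ (s j)) (Finset.mem_univ i)]
    simp only [Function.update_self, measure_univ, one_mul]
    rw [mul_comm]
    congr 1
    refine Finset.prod_congr rfl fun j hj => ?_
    rw [Function.update_of_ne (Finset.ne_of_mem_erase hj)]
  have hof : MeasurePreserving (WithLp.ofLp : Euc n → (Fin n → ℝ)) (gaussianEuc n η)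
      (Measure.pi fun _ : Fin n => γ) := by
    refine ⟨by fun_prop, ?_⟩
    rw [gaussianEuc, Measure.map_map (by fun_prop) (by fun_prop)]
    exact Measure.map_id
  have hto : MeasurePreserving (WithLp.toLp 2 : (Fin n → ℝ) → Euc n)
      (Measure.pi fun _ : Fin n => γ) (gaussianEuc n η) := ⟨by fun_prop, rfl⟩
  exact hto.comp (key.comp ((hof.comp (measurePreserving_neg_gaussianEuc n η)).prod
    (MeasurePreserving.id γ)))

theorem memLp_gaussianEuc_apply {n : ℕ} (η : ℝ) (i : Fin n) :
    MemLp (fun z : Euc n => z i) 2 (gaussianEuc n η) := by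
  have h := (measurePreserving_eval
    (fun _ : Fin n => gaussianReal 0 (Real.toNNReal (η ^ 2))) i)
  have h2 := (memLp_id_gaussianReal (μ := 0) (v := Real.toNNReal (η ^ 2))
    2).comp_measurePreserving h
  rw [gaussianEuc, memLp_map_measure_iff (by fun_prop) (by fun_prop)]
  exact h2

theorem integral_sq_gaussianEuc_apply {n : ℕ} (η : ℝ) (i : Fin n) :
    ∫ z : Euc n, (z i) ^ 2 ∂gaussianEuc n η = η ^ 2 := by
  have h := (measurePreserving_eval
    (fun _ : Fin n => gaussianReal 0 (Real.toNNReal (η ^ 2))) i)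
  rw [gaussianEuc, integral_map (by fun_prop) (by fun_prop)]
  have h3 : ∫ t : ℝ, t ^ 2 ∂gaussianReal 0 (Real.toNNReal (η ^ 2)) = η ^ 2 := by
    have := variance_id_gaussianReal (μ := 0) (v := Real.toNNReal (η ^ 2))
    rw [variance_of_integral_eq_zero (by fun_prop) (by simp)] at this
    simpa [sq_nonneg] using this
  conv_rhs => rw [← h3, ← h.map_eq, integral_map h.measurable.aemeasurable (by fun_prop)]

theorem integrable_norm_sq_gaussianEuc (n : ℕ) (η : ℝ) :
    Integrable (fun z : Euc n => ‖z‖ ^ 2) (gaussianEuc n η) := by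
  simp_rw [EuclideanSpace.real_norm_sq_eq]
  exact integrable_finsetSum _ fun i _ => (memLp_gaussianEuc_apply η i).integrable_sq

theorem integral_norm_sq_gaussianEuc (n : ℕ) (η : ℝ) :
    ∫ z : Euc n, ‖z‖ ^ 2 ∂gaussianEuc n η = n * η ^ 2 := by
  simp_rw [EuclideanSpace.real_norm_sq_eq]
  rw [integral_finsetSum _ fun i _ => (memLp_gaussianEuc_apply η i).integrable_sq]
  simp [integral_sq_gaussianEuc_apply]

theorem integrable_norm_gaussianEuc (n : ℕ) (η : ℝ) :
    Integrable (fun z : Euc n => ‖z‖) (gaussianEuc n η) := by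
  refine ((integrable_norm_sq_gaussianEuc n η).add (integrable_const (1 : ℝ))).mono'
    (by fun_prop) (.of_forall fun z => ?_)
  simp only [norm_norm, Pi.add_apply]
  nlinarith [sq_nonneg (‖z‖ - 1), norm_nonneg z]

theorem integral_norm_gaussianEuc_le {n : ℕ} (hn : 0 < n) {η : ℝ} (hη : 0 < η) :
    ∫ z : Euc n, ‖z‖ ∂gaussianEuc n η ≤ √n * η := by
  have hn' : (0 : ℝ) < n := by exact_mod_cast hn
  set a := √n * η with ha
  have ha0 : 0 < a := by positivity
  have ha2 : a ^ 2 = n * η ^ 2 := by rw [ha, mul_pow, Real.sq_sqrt hn'.le]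
  -- Young's inequality `2a‖z‖ ≤ ‖z‖² + a²` with `a² = 𝔼‖Z‖²` replaces Cauchy–Schwarz.
  have h1 : ∫ z : Euc n, 2 * a * ‖z‖ ∂gaussianEuc n η ≤
      ∫ z : Euc n, (‖z‖ ^ 2 + a ^ 2) ∂gaussianEuc n η :=
    integral_mono ((integrable_norm_gaussianEuc n η).const_mul _)
      ((integrable_norm_sq_gaussianEuc n η).add (integrable_const _))
      fun z => by nlinarith [sq_nonneg (‖z‖ - a)]
  rw [integral_const_mul, integral_add (integrable_norm_sq_gaussianEuc n η) (integrable_const _),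
    integral_norm_sq_gaussianEuc, integral_const, probReal_univ, one_smul, ← ha2] at h1
  nlinarith

/-! ### Gaussian smoothing of a Lipschitz convex function -/

section Lipschitz

variable {n : ℕ} {f : Euc n → ℝ} {C : ℝ≥0}

theorem LipschitzWith.integrable_gaussianEuc (hf : LipschitzWith C f) (x : Euc n) (η : ℝ) :
    Integrable (fun z => f (x + z)) (gaussianEuc n η) := by
  refine (((integrable_norm_gaussianEuc n η).const_mul C).add
    (integrable_const ‖f x‖)).mono'
    ((hf.continuous.comp (continuous_const.add continuous_id)).aestronglyMeasurable)
    (.of_forall fun z => ?_)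
  have h1 := hf.norm_sub_le (x + z) x
  rw [add_sub_cancel_left] at h1
  have h2 := norm_sub_norm_le (f (x + z)) (f x)
  simp only [Pi.add_apply]
  linarith

theorem LipschitzWith.integral_gaussianEuc_le (hf : LipschitzWith C f) (hn : 0 < n) (x : Euc n)
    {η : ℝ} (hη : 0 < η) :
    ∫ z, f (x + z) ∂gaussianEuc n η ≤ f x + C * (√n * η) := by
  have h : ∫ z, f (x + z) ∂gaussianEuc n η ≤ ∫ z, (f x + C * ‖z‖) ∂gaussianEuc n η := by
    refine integral_mono (hf.integrable_gaussianEuc x η)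
      ((integrable_const _).add ((integrable_norm_gaussianEuc n η).const_mul _)) fun z => ?_
    have h1 := hf.norm_sub_le (x + z) x
    rw [add_sub_cancel_left] at h1
    have := (Real.le_norm_self _).trans h1
    linarith
  rw [integral_add (integrable_const _) ((integrable_norm_gaussianEuc n η).const_mul _),
    integral_const, probReal_univ, one_smul, integral_const_mul] at h
  exact h.trans (by gcongr; exact integral_norm_gaussianEuc_le hn hη)

/-- By symmetry of the Gaussian, Jensen's inequality reduces to midpoint convexity at `x + z` and `x
- z`. -/
theorem ConvexOn.le_integral_gaussianEuc (hc : ConvexOn ℝ Set.univ f) (hf : LipschitzWith C f)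
    (x : Euc n) (η : ℝ) : f x ≤ ∫ z, f (x + z) ∂gaussianEuc n η := by
  have hneg : ∫ z, f (x + -z) ∂gaussianEuc n η = ∫ z, f (x + z) ∂gaussianEuc n η :=
    (measurePreserving_neg_gaussianEuc n η).integral_comp
      (MeasurableEquiv.neg (Euc n)).measurableEmbedding (fun z => f (x + z))
  have hi := hf.integrable_gaussianEuc x η
  have hi' : Integrable (fun z => f (x + -z)) (gaussianEuc n η) :=
    (measurePreserving_neg_gaussianEuc n η).integrable_comp_of_integrable hi
  have h : ∫ _, f x ∂gaussianEuc n η ≤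
      ∫ z, (1 / 2 * f (x + z) + 1 / 2 * f (x + -z)) ∂gaussianEuc n η := by
    refine integral_mono (integrable_const _) ((hi.const_mul _).add (hi'.const_mul _)) fun z => ?_
    have := hc.2 (Set.mem_univ (x + z)) (Set.mem_univ (x + -z))
      (by norm_num : (0 : ℝ) ≤ 1 / 2) (by norm_num : (0 : ℝ) ≤ 1 / 2) (by norm_num)
    rw [← smul_add, show x + z + (x + -z) = (2 : ℝ) • x by rw [two_smul]; abel, smul_smul] at this
    simpa using this
  rw [integral_add (hi.const_mul _) (hi'.const_mul _), integral_const_mul, integral_const_mul, hneg,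
    integral_const, probReal_univ, one_smul] at h
  linarith

/-- The bound `C‖w‖` holds at every point, because `lineDeriv` is `0` where the line derivative does
not exist. -/
theorem LipschitzWith.integrable_lineDeriv_gaussianEuc (hf : LipschitzWith C f) (x w : Euc n)
    (η : ℝ) : Integrable (fun z => lineDeriv ℝ f (x + z) w) (gaussianEuc n η) := by
  refine (integrable_const (C * ‖w‖)).mono' ?_ (.of_forall fun z =>
    norm_lineDeriv_le_of_lipschitz ℝ hf)
  exact ((measurable_lineDeriv hf.continuous).comp
    (measurable_const.add measurable_id)).aestronglyMeasurable

/-- No differentiability is needed: both sides differentiate the same function of one variable up to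
a translation. -/
theorem deriv_shifted (i : Fin n) (x z : Euc n) (t : ℝ) :
    deriv (fun t => f (shifted i t x z)) t =
      lineDeriv ℝ f (shifted i t x z) (EuclideanSpace.single i 1) := by
  rw [lineDeriv]
  have : (fun r : ℝ => f (shifted i t x z + r • EuclideanSpace.single i 1)) =
      fun r => (fun t => f (shifted i t x z)) (t + r) := by
    ext r
    congr 1
    ext j
    by_cases h : j = i
    · subst h; simp [shifted]; ring
    · simp [shifted, h]
  rw [this, deriv_comp_const_add (fun t => f (shifted i t x z)), add_zero]

theorem lipschitzWith_shifted (i : Fin n) (x z : Euc n) :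
    LipschitzWith 1 (fun t => shifted i t x z) := by
  refine LipschitzWith.of_dist_le_mul fun s t => ?_
  have : shifted i s x z - shifted i t x z = EuclideanSpace.single i (s - t) := by
    ext j
    by_cases h : j = i
    · subst h; simp [shifted]
    · simp [shifted, h]
  rw [dist_eq_norm, this, PiLp.norm_single, NNReal.coe_one, one_mul, dist_eq_norm]

/-- The expectation of the gradient estimator is the gradient of the Gaussian smoothing. -/
theorem LipschitzWith.integral_esGs (hf : LipschitzWith C f) {η : ℝ} (hη : 0 < η) (x : Euc n)
    (i : Fin n) :
    ∫ z, ∫ v, 1 / (η * √(2 * Real.pi)) * (f (shifted i (η * √(2 * v)) x z) -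
        f (shifted i (-(η * √(2 * v))) x z)) ∂expMeasure 1 ∂gaussianEuc n η =
      ∫ z, lineDeriv ℝ f (x + z) (EuclideanSpace.single i 1) ∂gaussianEuc n η := by
  have hmp := measurePreserving_update_gaussianEuc η i
  have hmeas : Measurable fun z : Euc n => lineDeriv ℝ f (x + z) (EuclideanSpace.single i 1) :=
    (measurable_lineDeriv hf.continuous).comp (measurable_const.add measurable_id)
  -- Writing the Gaussian as the law of `-Z` with coordinate `i` resampled isolates that coordinate,
  -- to which the one-dimensional identity applies for each fixed `z`.
  conv_rhs => rw [← hmp.map_eq, integral_map hmp.measurable.aemeasurable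
    hmeas.aestronglyMeasurable]
  rw [integral_prod]
  · refine integral_congr_ae (.of_forall fun z => ?_)
    have hL : LipschitzWith C (fun t => f (shifted i t x z)) := by
      have := hf.comp (lipschitzWith_shifted i x z)
      rwa [mul_one] at this
    refine (hL.integral_expMeasure_sub hη).trans ?_
    simp only [deriv_shifted]
    simp only [shifted_eq_add]
  · exact hmp.integrable_comp_of_integrable (hf.integrable_lineDeriv_gaussianEuc x _ η)

/-- The gradient inequality from `x + z` to `y + z`, averaged over `z`, compares the smoothed
values. Smoothing does not decrease `f` at `x`, and raises it by at most `C√n η` at `y`. -/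
theorem ConvexOn.sub_le_sum_integral_lineDeriv (hc : ConvexOn ℝ Set.univ f)
    (hf : LipschitzWith C f) (hn : 0 < n) {η : ℝ} (hη : 0 < η) (x y : Euc n) :
    f x - f y - C * (√n * η) ≤ ∑ i, (∫ z, lineDeriv ℝ f (x + z) (EuclideanSpace.single i 1)
      ∂gaussianEuc n η) * (x i - y i) := by
  have hd : ∀ᵐ z ∂gaussianEuc n η, DifferentiableAt ℝ f (x + z) := by
    refine (gaussianEuc_absolutelyContinuous n hη).ae_le ?_
    exact (measurePreserving_add_left volume x).quasiMeasurePreserving.ae hf.ae_differentiableAt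
  have hi := fun i => (hf.integrable_lineDeriv_gaussianEuc x (EuclideanSpace.single i 1)
    η).mul_const (x i - y i)
  have h1 : ∫ z, (f (x + z) - f (y + z)) ∂gaussianEuc n η ≤
      ∫ z, ∑ i, lineDeriv ℝ f (x + z) (EuclideanSpace.single i 1) * (x i - y i)
        ∂gaussianEuc n η := by
    refine integral_mono_ae ((hf.integrable_gaussianEuc x η).sub (hf.integrable_gaussianEuc y η))
      (integrable_finsetSum _ fun i _ => hi i) ?_
    filter_upwards [hd] with z hz
    have h2 := hc.add_fderiv_le hz (y - x)
    have h3 : fderiv ℝ f (x + z) (x - y) =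
        ∑ i, lineDeriv ℝ f (x + z) (EuclideanSpace.single i 1) * (x i - y i) := by
      have : x - y = ∑ i, (x i - y i) • EuclideanSpace.single i (1 : ℝ) := by
        have := (EuclideanSpace.basisFun (Fin n) ℝ).sum_repr (x - y)
        simpa using this.symm
      conv_lhs => rw [this, map_sum]
      refine Finset.sum_congr rfl fun i _ => ?_
      rw [map_smul, hz.lineDeriv_eq_fderiv, smul_eq_mul, mul_comm]
    rw [← h3]
    rw [show x + z + (y - x) = y + z by abel, ← neg_sub x y, map_neg] at h2
    linarith
  rw [integral_sub (hf.integrable_gaussianEuc x η) (hf.integrable_gaussianEuc y η),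
    integral_finsetSum _ fun i _ => hi i] at h1
  simp_rw [integral_mul_const] at h1
  have := hc.le_integral_gaussianEuc hf x η
  have := hf.integral_gaussianEuc_le hn y hη
  linarith

end Lipschitz

/-! ### Second moments and `L²` norms -/

section LpNorm

variable {α : Type*} [MeasurableSpace α] {μ : Measure α} {g : α → ℝ}

theorem eLpNorm_two_sq_eq_lintegral (g : α → ℝ) (μ : Measure α) :
    eLpNorm g 2 μ ^ 2 = ∫⁻ a, ENNReal.ofReal (g a ^ 2) ∂μ := by
  have h := eLpNorm_nnreal_pow_eq_lintegral (f := g) (μ := μ) (p := 2) two_ne_zero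
  simp only [NNReal.coe_ofNat, ENNReal.rpow_ofNat, ENNReal.coe_ofNat] at h
  rw [h]
  refine lintegral_congr fun a => ?_
  rw [Real.enorm_eq_ofReal_abs, ← ENNReal.ofReal_pow (abs_nonneg _), sq_abs]

theorem lintegral_sq_le_of_eLpNorm_le {c : ℝ} (h : eLpNorm g 2 μ ≤ ENNReal.ofReal c) :
    ∫⁻ a, ENNReal.ofReal (g a ^ 2) ∂μ ≤ ENNReal.ofReal (c ^ 2) := by
  rw [← eLpNorm_two_sq_eq_lintegral]
  refine (pow_le_pow_left' h 2).trans ?_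
  rcases le_total 0 c with hc | hc
  · rw [ENNReal.ofReal_pow hc]
  · simp [ENNReal.ofReal_of_nonpos hc]

theorem eLpNorm_le_of_lintegral_sq_le {c : ℝ} (hc : 0 ≤ c)
    (h : ∫⁻ a, ENNReal.ofReal (g a ^ 2) ∂μ ≤ ENNReal.ofReal (c ^ 2)) :
    eLpNorm g 2 μ ≤ ENNReal.ofReal c := by
  rw [← eLpNorm_two_sq_eq_lintegral, ENNReal.ofReal_pow hc] at h
  exact (ENNReal.pow_le_pow_left_iff two_ne_zero).mp h

theorem abs_integral_le_of_eLpNorm_two_le [IsProbabilityMeasure μ] (hg : AEStronglyMeasurable g μ)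
    {c : ℝ} (hc : 0 ≤ c) (h : eLpNorm g 2 μ ≤ ENNReal.ofReal c) : |∫ a, g a ∂μ| ≤ c := by
  have h1 := (enorm_integral_le_lintegral_enorm g).trans_eq
    (eLpNorm_one_eq_lintegral_enorm (μ := μ)).symm
  have h2 := (h1.trans (eLpNorm_le_eLpNorm_of_exponent_le one_le_two hg)).trans h
  rwa [Real.enorm_eq_ofReal_abs, ENNReal.ofReal_le_ofReal_iff hc] at h2

end LpNorm

/-! ### Symmetric Kullback–Leibler divergence of densities -/

section KullbackLeibler

/-- For `b ≤ a`, `log (a/b) ≥ 1 - b/a` gives `a - b ≤ a (log a - log b)`, and `a ≤ m`. This bounds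
squared density differences by the integrand of the symmetric divergence. -/
theorem sq_sub_le_mul_log_sub_log {a b m : ℝ} (ha : 0 < a) (hb : 0 < b) (ham : a ≤ m)
    (hbm : b ≤ m) : (a - b) ^ 2 ≤ m * ((a - b) * (Real.log a - Real.log b)) := by
  wlog hab : b ≤ a generalizing a b
  · have := this hb ha hbm ham (le_of_not_ge hab)
    nlinarith
  have h := Real.one_sub_inv_le_log_of_pos (div_pos ha hb)
  rw [inv_div, Real.log_div ha.ne' hb.ne'] at h
  have h0 : 0 ≤ Real.log a - Real.log b := sub_nonneg.mpr (Real.log_le_log hb hab)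
  have h1 : a - b ≤ a * (Real.log a - Real.log b) := by
    have : a * (1 - b / a) = a - b := by field_simp
    rw [← this]
    gcongr
  have h2 : a - b ≤ m * (Real.log a - Real.log b) := h1.trans (by gcongr)
  nlinarith [mul_le_mul_of_nonneg_left h2 (sub_nonneg.mpr hab)]

/-- The affine parts of the two `klFun` terms cancel. -/
theorem mul_klFun_div_add {a b : ℝ} (ha : 0 < a) (hb : 0 < b) :
    b * InformationTheory.klFun (a / b) + a * InformationTheory.klFun (b / a) =
      (a - b) * (Real.log a - Real.log b) := by
  simp only [InformationTheory.klFun, Real.log_div ha.ne' hb.ne', Real.log_div hb.ne' ha.ne']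
  field_simp
  ring

variable {d : ℕ} {p q : Euc d → ℝ}

/-- The Radon–Nikodym derivative is determined only where `q > 0`, but its product with `q` is a
Lebesgue density of the first measure, hence agrees with `p` Lebesgue-a.e. -/
theorem ae_eq_mul_rnDeriv_densityMeasure (hp : Measurable p) (hq : Measurable q)
    (hp0 : ∀ ξ, 0 ≤ p ξ) (hq0 : ∀ ξ, 0 ≤ q ξ) [IsProbabilityMeasure (densityMeasure p)]
    [IsProbabilityMeasure (densityMeasure q)] (h : densityMeasure p ≪ densityMeasure q) :
    ∀ᵐ ξ, p ξ = q ξ * ((densityMeasure p).rnDeriv (densityMeasure q) ξ).toReal := by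
  set r := (densityMeasure p).rnDeriv (densityMeasure q)
  have hr : Measurable r := Measure.measurable_rnDeriv _ _
  have h1 : volume.withDensity ((fun ξ => ENNReal.ofReal (q ξ)) * r) =
      volume.withDensity (fun ξ => ENNReal.ofReal (p ξ)) := by
    rw [withDensity_mul _ (by fun_prop) hr]
    exact Measure.withDensity_rnDeriv_eq _ _ h
  have hfin : ∫⁻ ξ, ENNReal.ofReal (p ξ) ≠ ⊤ := by
    have : densityMeasure p Set.univ = 1 := measure_univ
    rw [densityMeasure, withDensity_apply _ MeasurableSet.univ, setLIntegral_univ] at this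
    simp [this]
  have h2 := (withDensity_eq_iff (by fun_prop) (by fun_prop) hfin).mp h1.symm
  filter_upwards [h2] with ξ hξ
  have := congrArg ENNReal.toReal hξ
  rwa [Pi.mul_apply, ENNReal.toReal_mul, ENNReal.toReal_ofReal (hp0 ξ),
    ENNReal.toReal_ofReal (hq0 ξ)] at this

theorem klDiv_densityMeasure (hq : Measurable q) [IsProbabilityMeasure (densityMeasure p)]
    [IsProbabilityMeasure (densityMeasure q)] (h : densityMeasure p ≪ densityMeasure q) :
    InformationTheory.klDiv (densityMeasure p) (densityMeasure q) =
      ∫⁻ ξ, ENNReal.ofReal (q ξ) * ENNReal.ofReal (InformationTheory.klFun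
        ((densityMeasure p).rnDeriv (densityMeasure q) ξ).toReal) := by
  rw [InformationTheory.klDiv_eq_lintegral_klFun_of_ac h]
  have hm : Measurable fun ξ => ENNReal.ofReal (InformationTheory.klFun
      ((densityMeasure p).rnDeriv (densityMeasure q) ξ).toReal) :=
    (InformationTheory.measurable_klFun.comp
      (Measure.measurable_rnDeriv _ _).ennreal_toReal).ennreal_ofReal
  conv_lhs => rw [densityMeasure.eq_1 q]
  exact lintegral_withDensity_eq_lintegral_mul _ (by fun_prop) hm

/-- Finite divergences force mutual absolute continuity, hence a common support up to a null set. -/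
theorem ae_pos_iff_of_klDiv_ne_top (hp : Measurable p) (hq : Measurable q)
    (hp0 : ∀ ξ, 0 ≤ p ξ) (hq0 : ∀ ξ, 0 ≤ q ξ) [IsProbabilityMeasure (densityMeasure p)]
    [IsProbabilityMeasure (densityMeasure q)]
    (h : InformationTheory.klDiv (densityMeasure p) (densityMeasure q) +
      InformationTheory.klDiv (densityMeasure q) (densityMeasure p) ≠ ⊤) :
    ∀ᵐ ξ, (0 < p ξ ↔ 0 < q ξ) := by
  obtain ⟨h1, h2⟩ := ENNReal.add_ne_top.mp h
  filter_upwards [ae_eq_mul_rnDeriv_densityMeasure hp hq hp0 hq0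
      (InformationTheory.klDiv_ne_top_iff.mp h1).1,
    ae_eq_mul_rnDeriv_densityMeasure hq hp hq0 hp0
      (InformationTheory.klDiv_ne_top_iff.mp h2).1] with ξ e1 e2
  constructor <;> intro hpos <;> refine lt_of_le_of_ne (by simp [hp0, hq0]) fun h0 => ?_
  · rw [← h0, zero_mul] at e1; exact hpos.ne' e1
  · rw [← h0, zero_mul] at e2; exact hpos.ne' e2

theorem lintegral_sub_mul_log_sub_log_le (hp : Measurable p) (hq : Measurable q)
    (hp0 : ∀ ξ, 0 ≤ p ξ) (hq0 : ∀ ξ, 0 ≤ q ξ) [IsProbabilityMeasure (densityMeasure p)]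
    [IsProbabilityMeasure (densityMeasure q)] :
    ∫⁻ ξ, ENNReal.ofReal ((p ξ - q ξ) * (Real.log (p ξ) - Real.log (q ξ))) ≤
      InformationTheory.klDiv (densityMeasure p) (densityMeasure q) +
        InformationTheory.klDiv (densityMeasure q) (densityMeasure p) := by
  by_cases h : InformationTheory.klDiv (densityMeasure p) (densityMeasure q) +
      InformationTheory.klDiv (densityMeasure q) (densityMeasure p) = ⊤
  · rw [h]; exact le_top
  obtain ⟨h1, h2⟩ := ENNReal.add_ne_top.mp h
  have a1 := (InformationTheory.klDiv_ne_top_iff.mp h1).1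
  have a2 := (InformationTheory.klDiv_ne_top_iff.mp h2).1
  rw [klDiv_densityMeasure hq a1, klDiv_densityMeasure hp a2, ← lintegral_add_left]
  swap
  · exact (by fun_prop : Measurable fun ξ => ENNReal.ofReal (q ξ)).mul
      (InformationTheory.measurable_klFun.comp
        (Measure.measurable_rnDeriv _ _).ennreal_toReal).ennreal_ofReal
  refine lintegral_mono_ae ?_
  filter_upwards [ae_eq_mul_rnDeriv_densityMeasure hp hq hp0 hq0 a1,
    ae_eq_mul_rnDeriv_densityMeasure hq hp hq0 hp0 a2, ae_pos_iff_of_klDiv_ne_top hp hq hp0 hq0 h]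
    with ξ e1 e2 e3
  -- Off the common support both densities vanish, so the value of `Real.log 0` plays no role.
  rcases (hp0 ξ).eq_or_lt with h0 | hpos
  · have hq' : q ξ = 0 := by
      by_contra hne
      have := e3.mpr (lt_of_le_of_ne (hq0 ξ) (Ne.symm hne))
      exact this.ne h0
    simp [← h0, hq']
  · have hqpos := e3.mp hpos
    rw [← mul_klFun_div_add hpos hqpos, (div_eq_iff hqpos.ne').mpr (e1.trans (mul_comm _ _)),
      (div_eq_iff hpos.ne').mpr (e2.trans (mul_comm _ _)),
      ← ENNReal.ofReal_mul hqpos.le, ← ENNReal.ofReal_mul hpos.le]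
    exact ENNReal.ofReal_add_le

end KullbackLeibler

/-! ### Reduction of the three settings to one -/

/-- What the three settings have in common: the sampled function is an unbiased estimator of the
objective that is Lipschitz in the `L²` norm, and the objective is convex. -/
structure StochModel.IsRegular {n : ℕ} (L : ℝ) (P : StochModel n) : Prop where
  prob : IsProbabilityMeasure P.law
  meas : Measurable (Function.uncurry P.sample)
  integrable : ∀ x, Integrable (P.sample x) P.law
  obj_eq : ∀ x, P.obj x = ∫ s, P.sample x s ∂P.law
  lipschitz : ∀ x y, eLpNorm (fun s => P.sample x s - P.sample y s) 2 P.law ≤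
    ENNReal.ofReal (L * ‖x - y‖)
  convex : ConvexOn ℝ Set.univ P.obj

theorem StandardAssumptions.isRegular {n d : ℕ} {L : ℝ} {F : Euc n → Euc d → ℝ}
    {μ : Measure (Euc d)} (h : StandardAssumptions L F μ) : (standardModel F μ).IsRegular L where
  prob := h.prob
  meas := h.meas
  integrable := h.integrable
  obj_eq _ := rfl
  lipschitz := h.lipschitz
  convex := by
    refine ⟨convex_univ, fun x _ y _ a b ha hb hab => ?_⟩
    change ∫ ξ, F (a • x + b • y) ξ ∂μ ≤ a • ∫ ξ, F x ξ ∂μ + b • ∫ ξ, F y ξ ∂μ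
    rw [← integral_smul a (F x), ← integral_smul b (F y)]
    refine le_of_le_of_eq ?_ (integral_add ((h.integrable x).smul a) ((h.integrable y).smul b))
    refine integral_mono_ae (h.integrable _) (((h.integrable x).smul a).add
      ((h.integrable y).smul b)) ?_
    filter_upwards [h.convex] with ξ hξ
    exact hξ.2 (Set.mem_univ x) (Set.mem_univ y) ha hb hab

theorem RandomFieldAssumptions.isRegular {n d : ℕ} {S : Type} [MeasurableSpace S] {L : ℝ}
    {F : Euc n → Euc d → ℝ} {𝒟 : Euc n → Measure (Euc d)} {ρ : Measure S}
    {field : Euc n → S → Euc d} (h : RandomFieldAssumptions L F 𝒟 ρ field) :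
    (randomFieldModel F 𝒟 ρ field).IsRegular L := by
  have hfield : ∀ x, Measurable (field x) := fun x => h.meas_field.of_uncurry_left
  have hF : ∀ x, Measurable (F x) := fun x => h.meas_F.of_uncurry_left
  exact
  { prob := h.prob
    meas := h.meas_F.comp (measurable_fst.prodMk h.meas_field)
    integrable := fun x => by
      have := h.integrable x
      rw [← h.marginal x] at this
      exact this.comp_measurable (hfield x)
    obj_eq := fun x => by
      change ∫ ξ, F x ξ ∂(𝒟 x) = ∫ s, F x (field x s) ∂ρ
      rw [← h.marginal x, integral_map (hfield x).aemeasurable (hF x).aestronglyMeasurable]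
    lipschitz := h.lipschitz
    convex := h.convex }

/-! ### The setting with known densities -/

section KnownDensity

variable {n d : ℕ} {Lξ M Lf Mf : ℝ} {F : Euc n → Euc d → ℝ} {p : Euc n → Euc d → ℝ}
  {q : Euc d → ℝ}

theorem KnownDensityAssumptions.ratio_le_abs (h : KnownDensityAssumptions Lξ M Lf Mf F p q)
    (x : Euc n) (ξ : Euc d) : |p x ξ / q ξ| ≤ |M| := by
  rcases (h.nonneg_p x ξ).eq_or_lt with h0 | hpos
  · simp [← h0]
  · rw [abs_of_nonneg (div_nonneg hpos.le (h.nonneg_q ξ))]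
    exact (h.ratio_le x ξ hpos).2.trans (le_abs_self M)

/-- Where `q` vanishes, so does `p x`, and the convention for division by zero is harmless. -/
theorem KnownDensityAssumptions.mul_div_cancel (h : KnownDensityAssumptions Lξ M Lf Mf F p q)
    (x : Euc n) (ξ : Euc d) : q ξ * (p x ξ / q ξ) = p x ξ := by
  rcases (h.nonneg_p x ξ).eq_or_lt with h0 | hpos
  · simp [← h0]
  · exact mul_div_cancel₀ _ (h.ratio_le x ξ hpos).1.ne'

/-- A probability density is positive somewhere, and there `M` bounds a positive ratio. -/
theorem KnownDensityAssumptions.nonneg_M (h : KnownDensityAssumptions Lξ M Lf Mf F p q) :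
    0 ≤ M := by
  have := h.prob_p 0
  by_contra hM
  have h0 : ∀ ξ, p 0 ξ = 0 := fun ξ => by
    rcases (h.nonneg_p 0 ξ).eq_or_lt with h0 | hpos
    · exact h0.symm
    · obtain ⟨h1, h2⟩ := h.ratio_le 0 ξ hpos
      exact absurd ((div_pos hpos h1).le.trans h2) hM
  have h1 : densityMeasure (p 0) Set.univ = 1 := measure_univ
  simp [densityMeasure, h0] at h1

/-- On the common support `F y` is bounded by `Mf`, and both densities are at most `M q`, so `(p x -
p y)²/q` is at most `M` times the integrand of the symmetric divergence. -/
theorem KnownDensityAssumptions.lintegral_sq_mul_sub_le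
    (h : KnownDensityAssumptions Lξ M Lf Mf F p q) (x y : Euc n) :
    ∫⁻ ξ, ENNReal.ofReal ((F y ξ * (p x ξ / q ξ - p y ξ / q ξ)) ^ 2) ∂densityMeasure q ≤
      ENNReal.ofReal (M * Mf ^ 2 * Lξ ^ 2 * ‖x - y‖ ^ 2) := by
  have := h.prob_p x
  have := h.prob_p y
  have hpx : Measurable (p x) := h.meas_p.of_uncurry_left
  have hpy : Measurable (p y) := h.meas_p.of_uncurry_left
  have hFy : Measurable (F y) := h.meas_F.of_uncurry_left
  have hq := h.meas_q
  have hM := h.nonneg_M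
  have hkl := h.kl_le x y
  have htop := ne_top_of_le_ne_top ENNReal.ofReal_ne_top hkl
  have hm : Measurable fun ξ => ENNReal.ofReal ((F y ξ * (p x ξ / q ξ - p y ξ / q ξ)) ^ 2) := by
    fun_prop
  rw [densityMeasure, lintegral_withDensity_eq_lintegral_mul _ (by fun_prop) hm]
  calc _ ≤ ∫⁻ ξ, ENNReal.ofReal (M * Mf ^ 2) * ENNReal.ofReal
        ((p x ξ - p y ξ) * (Real.log (p x ξ) - Real.log (p y ξ))) := by
        refine lintegral_mono_ae ?_
        filter_upwards [ae_pos_iff_of_klDiv_ne_top hpx hpy (h.nonneg_p x) (h.nonneg_p y) htop,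
          h.bounded y] with ξ hiff hb
        rw [Pi.mul_apply, ← ENNReal.ofReal_mul (h.nonneg_q ξ), ← ENNReal.ofReal_mul (by positivity)]
        rcases (h.nonneg_p y ξ).eq_or_lt with h0 | hy
        · have hx : p x ξ = 0 := by
            by_contra hne
            exact (hiff.mp (lt_of_le_of_ne (h.nonneg_p x ξ) (Ne.symm hne))).ne h0
          simp [← h0, hx]
        · have hx := hiff.mpr hy
          obtain ⟨hq0, hry⟩ := h.ratio_le y ξ hy
          have hrx := (h.ratio_le x ξ hx).2
          rw [div_le_iff₀ hq0] at hrx hry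
          refine ENNReal.ofReal_le_ofReal ?_
          have h1 := sq_sub_le_mul_log_sub_log hx hy hrx hry
          have h2 : F y ξ ^ 2 ≤ Mf ^ 2 := sq_le_sq' (by linarith [neg_abs_le (F y ξ), hb hy])
            ((le_abs_self _).trans (hb hy))
          have h3 : q ξ * (F y ξ * (p x ξ / q ξ - p y ξ / q ξ)) ^ 2 =
              F y ξ ^ 2 * (p x ξ - p y ξ) ^ 2 / q ξ := by
            field_simp
          rw [h3, div_le_iff₀ hq0]
          calc F y ξ ^ 2 * (p x ξ - p y ξ) ^ 2 ≤ Mf ^ 2 * (M * q ξ *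
              ((p x ξ - p y ξ) * (Real.log (p x ξ) - Real.log (p y ξ)))) := by gcongr
            _ = _ := by ring
    _ = ENNReal.ofReal (M * Mf ^ 2) * ∫⁻ ξ, ENNReal.ofReal
        ((p x ξ - p y ξ) * (Real.log (p x ξ) - Real.log (p y ξ))) :=
        lintegral_const_mul _ (by fun_prop)
    _ ≤ ENNReal.ofReal (M * Mf ^ 2) * ENNReal.ofReal (Lξ ^ 2 * ‖x - y‖ ^ 2) := by
        gcongr
        exact (lintegral_sub_mul_log_sub_log_le hpx hpy (h.nonneg_p x) (h.nonneg_p y)).trans hkl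
    _ = _ := by
        rw [← ENNReal.ofReal_mul (by positivity)]
        congr 1
        ring

theorem KnownDensityAssumptions.lintegral_sq_sub_mul_le
    (h : KnownDensityAssumptions Lξ M Lf Mf F p q) (x y : Euc n) :
    ∫⁻ ξ, ENNReal.ofReal (((F x ξ - F y ξ) * (p x ξ / q ξ)) ^ 2) ∂densityMeasure q ≤
      ENNReal.ofReal (M ^ 2 * Lf ^ 2 * ‖x - y‖ ^ 2) := by
  have hFx : Measurable (F x) := h.meas_F.of_uncurry_left
  have hFy : Measurable (F y) := h.meas_F.of_uncurry_left
  calc _ ≤ ∫⁻ ξ, ENNReal.ofReal (M ^ 2) * ENNReal.ofReal ((F x ξ - F y ξ) ^ 2)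
        ∂densityMeasure q := by
        refine lintegral_mono fun ξ => ?_
        rw [← ENNReal.ofReal_mul (sq_nonneg _), mul_pow, mul_comm]
        refine ENNReal.ofReal_le_ofReal ?_
        gcongr ?_ * _
        exact sq_le_sq.mpr (h.ratio_le_abs x ξ)
    _ = ENNReal.ofReal (M ^ 2) * ∫⁻ ξ, ENNReal.ofReal ((F x ξ - F y ξ) ^ 2) ∂densityMeasure q :=
        lintegral_const_mul _ (by fun_prop)
    _ ≤ ENNReal.ofReal (M ^ 2) * ENNReal.ofReal ((Lf * ‖x - y‖) ^ 2) := by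
        gcongr
        exact lintegral_sq_le_of_eLpNorm_le (h.lipschitz x y)
    _ = _ := by
        rw [← ENNReal.ofReal_mul (by positivity)]
        congr 1
        ring

theorem KnownDensityAssumptions.isRegular (h : KnownDensityAssumptions Lξ M Lf Mf F p q) :
    (knownDensityModel F p q).IsRegular √(2 * (M ^ 2 * Lf ^ 2 + M * Mf ^ 2 * Lξ ^ 2)) := by
  have hM := h.nonneg_M
  have hq := h.meas_q
  have := h.prob_q
  have hF : ∀ x, Measurable (F x) := fun x => h.meas_F.of_uncurry_left
  have hp : ∀ x, Measurable (p x) := fun x => h.meas_p.of_uncurry_left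
  refine ⟨h.prob_q, ?_, fun x => ?_, fun x => ?_, fun x y => ?_, h.convex⟩
  · exact h.meas_F.mul (h.meas_p.div (hq.comp measurable_snd))
  · change Integrable (fun ξ => F x ξ * (p x ξ / q ξ)) (densityMeasure q)
    refine Integrable.of_bound ((hF x).mul ((hp x).div hq)).aestronglyMeasurable
      (|Mf| * |M|) ((withDensity_absolutelyContinuous _ _).ae_le ?_)
    filter_upwards [h.bounded x] with ξ hξ
    rcases (h.nonneg_p x ξ).eq_or_lt with h0 | hpos
    · simp only [← h0, zero_div, mul_zero, norm_zero]; positivity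
    · rw [norm_mul]
      exact mul_le_mul ((hξ hpos).trans (le_abs_self _)) (h.ratio_le_abs x ξ) (norm_nonneg _)
        (abs_nonneg _)
  · change ∫ ξ, F x ξ * p x ξ = ∫ ξ, F x ξ * (p x ξ / q ξ) ∂densityMeasure q
    rw [densityMeasure, integral_withDensity_eq_integral_toReal_smul (by fun_prop)
      (.of_forall fun _ => ENNReal.ofReal_lt_top)]
    refine integral_congr_ae (.of_forall fun ξ => ?_)
    simp only [ENNReal.toReal_ofReal (h.nonneg_q ξ), smul_eq_mul]
    rw [mul_left_comm, h.mul_div_cancel x ξ]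
  · change eLpNorm (fun ξ => F x ξ * (p x ξ / q ξ) - F y ξ * (p y ξ / q ξ)) 2 (densityMeasure q) ≤ _
    refine eLpNorm_le_of_lintegral_sq_le (by positivity) ?_
    have hFx := hF x
    have hFy := hF y
    have hpx := hp x
    have hpy := hp y
    calc _ ≤ ∫⁻ ξ, (2 * ENNReal.ofReal (((F x ξ - F y ξ) * (p x ξ / q ξ)) ^ 2) +
          2 * ENNReal.ofReal ((F y ξ * (p x ξ / q ξ - p y ξ / q ξ)) ^ 2)) ∂densityMeasure q := by
          refine lintegral_mono fun ξ => ?_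
          rw [← mul_add, ← ENNReal.ofReal_add (sq_nonneg _) (sq_nonneg _),
            ← ENNReal.ofReal_ofNat 2, ← ENNReal.ofReal_mul zero_le_two]
          refine ENNReal.ofReal_le_ofReal ?_
          -- Splitting at `F y · p x/q` and using `(u + v)² ≤ 2u² + 2v²` produces the factor `2` in
          -- `L₀²`.
          have e : F x ξ * (p x ξ / q ξ) - F y ξ * (p y ξ / q ξ) =
            (F x ξ - F y ξ) * (p x ξ / q ξ) + F y ξ * (p x ξ / q ξ - p y ξ / q ξ) := by ring
          rw [e]
          nlinarith [sq_nonneg ((F x ξ - F y ξ) * (p x ξ / q ξ) -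
            F y ξ * (p x ξ / q ξ - p y ξ / q ξ))]
      _ ≤ 2 * ENNReal.ofReal (M ^ 2 * Lf ^ 2 * ‖x - y‖ ^ 2) +
          2 * ENNReal.ofReal (M * Mf ^ 2 * Lξ ^ 2 * ‖x - y‖ ^ 2) := by
          rw [lintegral_add_left (by fun_prop), lintegral_const_mul _ (by fun_prop),
            lintegral_const_mul _ (by fun_prop)]
          gcongr
          · exact h.lintegral_sq_sub_mul_le x y
          · exact h.lintegral_sq_mul_sub_le x y
      _ = _ := by
          have h2 : (2 : ℝ≥0∞) = ENNReal.ofReal 2 := (ENNReal.ofReal_ofNat 2).symm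
          conv_lhs => rw [← mul_add, ← ENNReal.ofReal_add (by positivity) (by positivity)]
          refine (congrArg (· * _) h2).trans ?_
          rw [← ENNReal.ofReal_mul zero_le_two, mul_pow, Real.sq_sqrt (by positivity)]
          congr 1
          ring

end KnownDensity

theorem Admissible.isRegular {n : ℕ} {L₀ : ℝ} {P : StochModel n} (h : Admissible L₀ P) :
    P.IsRegular L₀ := by
  cases h with
  | standard F μ h => exact h.isRegular
  | knownDensity Lξ M Lf Mf F p q h hL => rw [hL]; exact h.isRegular
  | randomField F 𝒟 ρ field h => exact h.isRegular

/-! ### Mean and second moment of the gradient estimator -/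

namespace StochModel

variable {n : ℕ} (P : StochModel n)

/-- The law of the triple `(V, Z, s)` drawn in each iteration. -/
noncomputable def drawLaw (η : ℝ) : Measure (ℝ × Euc n × P.S) :=
  (expMeasure 1).prod ((gaussianEuc n η).prod P.law)

/-- The value of the gradient estimator. -/
noncomputable def grad (η : ℝ) (x : Euc n) (t : ℝ × Euc n × P.S) : Euc n :=
  (P.esGs η x t.1 t.2.1 t.2.2).val

theorem grad_apply (η : ℝ) (x : Euc n) (t : ℝ × Euc n × P.S) (i : Fin n) :
    P.grad η x t i = 1 / (η * √(2 * Real.pi)) *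
      (P.sample (shifted i (η * √(2 * t.1)) x t.2.1) t.2.2 -
        P.sample (shifted i (-(η * √(2 * t.1))) x t.2.1) t.2.2) := rfl

theorem iterate_succ {Ω : Type*} {X : Set (Euc n)} {x₀ : Euc n} {γ : ℕ → ℝ} {η : ℝ}
    {V : ℕ → Ω → ℝ} {Z : ℕ → Ω → Euc n} {s : ℕ → Ω → P.S} (k : ℕ) (ω : Ω) :
    P.iterate X x₀ γ η V Z s (k + 1) ω =
    eucProj X (P.iterate X x₀ γ η V Z s k ω -
      γ k • P.grad η (P.iterate X x₀ γ η V Z s k ω) (V k ω, Z k ω, s k ω)) := rfl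

attribute [irreducible] grad

theorem esGs_evals (η : ℝ) (x : Euc n) (v : ℝ) (z : Euc n) (s : P.S) :
    (P.esGs η x v z s).evals = 2 * n := by
  simp [esGs, Counted.vec, Counted.bind, Counted.pure, query, mul_comm]

theorem run_evals (X : Set (Euc n)) (x₀ : Euc n) (γ : ℕ → ℝ) (η : ℝ)
    (v : ℕ → ℝ) (z : ℕ → Euc n) (s : ℕ → P.S) (k : ℕ) :
    (P.run X x₀ γ η v z s k).evals = 2 * n * k := by
  induction k with
  | zero => rfl
  | succ k ih =>
    simp only [run, Counted.bind, Counted.pure, ih, esGs_evals]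
    ring

theorem measurable_shifted (i : Fin n) :
    Measurable fun q : ℝ × Euc n × Euc n => shifted i q.1 q.2.1 q.2.2 := by
  simp only [shifted]
  refine (WithLp.measurable_toLp 2 _).comp (measurable_pi_lambda _ fun j => ?_)
  by_cases h : j = i <;> simp only [h, if_true, if_false] <;> fun_prop

variable {P} {L : ℝ}

theorem IsRegular.measurable_grad (h : P.IsRegular L) (η : ℝ) :
    Measurable (Function.uncurry (P.grad η)) := by
  have key : ∀ (i : Fin n) (c : ℝ → ℝ), Measurable c →
      Measurable fun q : Euc n × ℝ × Euc n × P.S =>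
        P.sample (shifted i (c q.2.1) q.1 q.2.2.1) q.2.2.2 := fun i c hc =>
    h.meas.comp (((measurable_shifted i).comp ((hc.comp (by fun_prop)).prodMk
      (measurable_fst.prodMk (by fun_prop)))).prodMk (by fun_prop))
  have : Measurable fun q : Euc n × ℝ × Euc n × P.S => (P.grad η q.1 q.2).ofLp := by
    refine measurable_pi_lambda _ fun i => ?_
    simp only [grad_apply]
    exact ((key i (fun v => η * √(2 * v)) (by fun_prop)).sub
      (key i (fun v => -(η * √(2 * v))) (by fun_prop))).const_mul _
  exact (WithLp.measurable_toLp 2 _).comp this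

theorem IsRegular.measurable_grad_apply (h : P.IsRegular L) (η : ℝ) (x : Euc n) (i : Fin n) :
    Measurable fun t => P.grad η x t i :=
  (measurable_pi_apply i).comp
    ((WithLp.measurable_ofLp 2 _).comp (h.measurable_grad η).of_uncurry_left)

theorem IsRegular.isProbabilityMeasure_drawLaw (h : P.IsRegular L) (η : ℝ) :
    IsProbabilityMeasure (P.drawLaw η) := by
  have := h.prob
  have := isProbabilityMeasure_expMeasure one_pos
  unfold drawLaw
  infer_instance

theorem IsRegular.lipschitzWith_obj (h : P.IsRegular L) (hL : 0 ≤ L) :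
    LipschitzWith L.toNNReal P.obj := by
  have := h.prob
  refine LipschitzWith.of_dist_le_mul fun x y => ?_
  rw [Real.dist_eq, dist_eq_norm, Real.coe_toNNReal _ hL, h.obj_eq, h.obj_eq,
    ← integral_sub (h.integrable x) (h.integrable y)]
  exact abs_integral_le_of_eLpNorm_two_le
    ((h.integrable x).sub (h.integrable y)).aestronglyMeasurable (by positivity) (h.lipschitz x y)

theorem IsRegular.lintegral_grad_apply_sq_le (h : P.IsRegular L) {η : ℝ} (hη : 0 < η) (x : Euc n)
    (i : Fin n) :
    ∫⁻ t, ENNReal.ofReal (P.grad η x t i ^ 2) ∂P.drawLaw η ≤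
      ENNReal.ofReal (4 * L ^ 2 / Real.pi) := by
  have := h.prob
  have hm : Measurable fun t => ENNReal.ofReal (P.grad η x t i ^ 2) :=
    ((h.measurable_grad_apply η x i).pow_const 2).ennreal_ofReal
  have inner_le : ∀ v z, ∫⁻ s, ENNReal.ofReal (P.grad η x (v, z, s) i ^ 2) ∂P.law ≤
      ENNReal.ofReal (4 * L ^ 2 / Real.pi) * ENNReal.ofReal v := by
    intro v z
    set a := shifted i (η * √(2 * v)) x z
    set b := shifted i (-(η * √(2 * v))) x z
    have hab : ‖a - b‖ ≤ 2 * (η * √(2 * v)) := by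
      have h0 : 0 ≤ η * √(2 * v) := by positivity
      have := (lipschitzWith_shifted i x z).dist_le_mul (η * √(2 * v)) (-(η * √(2 * v)))
      rw [dist_eq_norm, Real.dist_eq, NNReal.coe_one, one_mul, sub_neg_eq_add, ← two_mul,
        abs_of_nonneg (by positivity)] at this
      exact this
    have hga : Measurable (P.sample a) := h.meas.of_uncurry_left
    have hgb : Measurable (P.sample b) := h.meas.of_uncurry_left
    calc ∫⁻ s, ENNReal.ofReal (P.grad η x (v, z, s) i ^ 2) ∂P.law
        = ∫⁻ s, ENNReal.ofReal ((1 / (η * √(2 * Real.pi))) ^ 2) *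
            ENNReal.ofReal ((P.sample a s - P.sample b s) ^ 2) ∂P.law := by
          refine lintegral_congr fun s => ?_
          rw [grad_apply, mul_pow, ENNReal.ofReal_mul (sq_nonneg _)]
      _ ≤ ENNReal.ofReal ((1 / (η * √(2 * Real.pi))) ^ 2) *
            ENNReal.ofReal ((L * ‖a - b‖) ^ 2) := by
          rw [lintegral_const_mul _ (by fun_prop)]
          gcongr
          exact lintegral_sq_le_of_eLpNorm_le (h.lipschitz a b)
      _ ≤ ENNReal.ofReal (4 * L ^ 2 / Real.pi) * ENNReal.ofReal v := by
          rw [← ENNReal.ofReal_mul (sq_nonneg _), ← ENNReal.ofReal_mul (by positivity)]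
          -- For `v ≤ 0` the truncated square root makes the two points coincide, matching
          -- `ENNReal.ofReal v = 0`.
          rcases le_total v 0 with hv | hv
          · have : √(2 * v) = 0 := Real.sqrt_eq_zero_of_nonpos (by linarith)
            rw [this, mul_zero, mul_zero] at hab
            have h0 : ‖a - b‖ = 0 := le_antisymm hab (norm_nonneg _)
            rw [h0]
            simp
          · refine ENNReal.ofReal_le_ofReal ?_
            have h1 : (L * ‖a - b‖) ^ 2 ≤ L ^ 2 * (2 * (η * √(2 * v))) ^ 2 := by
              rw [mul_pow]
              gcongr
            -- Here `L²·8η²v/(2πη²) = 4L²v/π`: the smoothing parameter cancels.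
            refine (mul_le_mul_of_nonneg_left h1 (sq_nonneg _)).trans_eq ?_
            rw [div_pow, mul_pow, mul_pow, mul_pow, Real.sq_sqrt (by positivity),
              Real.sq_sqrt (by positivity)]
            field_simp
            ring
  calc ∫⁻ t, ENNReal.ofReal (P.grad η x t i ^ 2) ∂P.drawLaw η
      = ∫⁻ v, ∫⁻ q, ENNReal.ofReal (P.grad η x (v, q) i ^ 2)
          ∂(gaussianEuc n η).prod P.law ∂expMeasure 1 := lintegral_prod _ hm.aemeasurable
    _ = ∫⁻ v, ∫⁻ z, ∫⁻ s, ENNReal.ofReal (P.grad η x (v, z, s) i ^ 2)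
          ∂P.law ∂gaussianEuc n η ∂expMeasure 1 := by
        refine lintegral_congr fun v => ?_
        exact lintegral_prod _ (hm.comp measurable_prodMk_left).aemeasurable
    _ ≤ ∫⁻ v, ∫⁻ _, ENNReal.ofReal (4 * L ^ 2 / Real.pi) * ENNReal.ofReal v
          ∂gaussianEuc n η ∂expMeasure 1 :=
        lintegral_mono fun v => lintegral_mono fun z => inner_le v z
    _ = ENNReal.ofReal (4 * L ^ 2 / Real.pi) := by
        simp_rw [lintegral_const, measure_univ, mul_one]
        rw [lintegral_const_mul _ (by fun_prop), lintegral_ofReal_expMeasure, mul_one]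

theorem IsRegular.lintegral_norm_grad_sq_le (h : P.IsRegular L) {η : ℝ} (hη : 0 < η) (x : Euc n) :
    ∫⁻ t, ENNReal.ofReal (‖P.grad η x t‖ ^ 2) ∂P.drawLaw η ≤
      ENNReal.ofReal (4 * n * L ^ 2 / Real.pi) := by
  simp_rw [EuclideanSpace.real_norm_sq_eq, ENNReal.ofReal_sum_of_nonneg fun _ _ => sq_nonneg _]
  rw [lintegral_finsetSum _ fun i _ =>
    ((h.measurable_grad_apply η x i).pow_const 2).ennreal_ofReal]
  refine (Finset.sum_le_sum fun i _ => h.lintegral_grad_apply_sq_le hη x i).trans_eq ?_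
  rw [← ENNReal.ofReal_sum_of_nonneg fun _ _ => by positivity]
  simp only [Finset.sum_const, Finset.card_univ, Fintype.card_fin, nsmul_eq_mul]
  congr 1
  ring

theorem IsRegular.integrable_grad_apply (h : P.IsRegular L) {η : ℝ} (hη : 0 < η) (x : Euc n)
    (i : Fin n) : Integrable (fun t => P.grad η x t i) (P.drawLaw η) := by
  have := h.isProbabilityMeasure_drawLaw η
  have hm : AEStronglyMeasurable (fun t => P.grad η x t i) (P.drawLaw η) :=
    (h.measurable_grad_apply η x i).aestronglyMeasurable
  have h2 : MemLp (fun t => P.grad η x t i) 2 (P.drawLaw η) := by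
    rw [memLp_two_iff_integrable_sq hm]
    refine ⟨hm.pow 2, ?_⟩
    rw [hasFiniteIntegral_iff_ofReal (.of_forall fun _ => sq_nonneg _)]
    exact (h.lintegral_grad_apply_sq_le hη x i).trans_lt ENNReal.ofReal_lt_top
  exact h2.integrable one_le_two

theorem IsRegular.integral_grad_apply (h : P.IsRegular L) (hL : 0 ≤ L) {η : ℝ} (hη : 0 < η)
    (x : Euc n) (i : Fin n) :
    ∫ t, P.grad η x t i ∂P.drawLaw η =
      ∫ z, lineDeriv ℝ P.obj (x + z) (EuclideanSpace.single i 1) ∂gaussianEuc n η := by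
  have := h.prob
  have := isProbabilityMeasure_expMeasure one_pos
  have hi := h.integrable_grad_apply hη x i
  -- Reassociating lets `s` be integrated first, which by unbiasedness replaces the sample by the
  -- objective; the smoothing identity then handles `v` and `z`.
  have hmp := measurePreserving_prodAssoc (expMeasure 1) (gaussianEuc n η) P.law
  have hi' : Integrable (fun q : (ℝ × Euc n) × P.S => P.grad η x (q.1.1, q.1.2, q.2) i)
      (((expMeasure 1).prod (gaussianEuc n η)).prod P.law) :=
    hmp.integrable_comp_of_integrable hi
  have e : ∀ q : ℝ × Euc n, ∫ s, P.grad η x (q.1, q.2, s) i ∂P.law =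
      1 / (η * √(2 * Real.pi)) * (P.obj (shifted i (η * √(2 * q.1)) x q.2) -
        P.obj (shifted i (-(η * √(2 * q.1))) x q.2)) := fun q => by
    simp only [grad_apply]
    rw [integral_const_mul, integral_sub (h.integrable _) (h.integrable _), ← h.obj_eq, ← h.obj_eq]
  have hi2 := hi'.integral_prod_left
  simp only [e] at hi2
  calc ∫ t, P.grad η x t i ∂P.drawLaw η
      = ∫ q : (ℝ × Euc n) × P.S, P.grad η x (q.1.1, q.1.2, q.2) i
          ∂((expMeasure 1).prod (gaussianEuc n η)).prod P.law :=
        (hmp.integral_comp MeasurableEquiv.prodAssoc.measurableEmbedding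
          (fun t => P.grad η x t i)).symm
    _ = ∫ q : ℝ × Euc n, 1 / (η * √(2 * Real.pi)) *
          (P.obj (shifted i (η * √(2 * q.1)) x q.2) -
            P.obj (shifted i (-(η * √(2 * q.1))) x q.2))
          ∂(expMeasure 1).prod (gaussianEuc n η) := by
        rw [integral_prod _ hi']
        simp only [e]
    _ = _ := by
        rw [integral_prod_symm _ hi2]
        exact (h.lipschitzWith_obj hL).integral_esGs hη x i

/-- In expectation, the estimator is an approximate subgradient of the objective. -/
theorem IsRegular.sub_le_integral_inner_grad (h : P.IsRegular L) (hL : 0 ≤ L) (hn : 0 < n) {η : ℝ}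
    (hη : 0 < η) (x y : Euc n) :
    P.obj x - P.obj y - L * (√n * η) ≤ ∫ t, inner ℝ (P.grad η x t) (x - y) ∂P.drawLaw η := by
  have h1 := h.convex.sub_le_sum_integral_lineDeriv (h.lipschitzWith_obj hL) hn hη x y
  rw [Real.coe_toNNReal _ hL] at h1
  refine h1.trans_eq ?_
  have : ∀ t, inner ℝ (P.grad η x t) (x - y) = ∑ i, P.grad η x t i * (x i - y i) := fun t => by
    simp [PiLp.inner_apply, mul_comm]
  simp only [this]
  rw [integral_finsetSum _ fun i _ => (h.integrable_grad_apply hη x i).mul_const _]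
  refine Finset.sum_congr rfl fun i _ => ?_
  rw [integral_mul_const, h.integral_grad_apply hL hη]

end StochModel

/-! ### Euclidean projection onto a closed convex set -/

section Projection

variable {n : ℕ} {X : Set (Euc n)}

theorem eucProj_spec (hX : Convex ℝ X) (hc : IsClosed X) (hne : X.Nonempty) (u : Euc n) :
    eucProj X u ∈ X ∧ ∀ y ∈ X, ‖u - eucProj X u‖ ≤ ‖u - y‖ := by
  obtain ⟨v, hv, h⟩ := exists_norm_eq_iInf_of_complete_convex hne hc.isComplete hX u
  refine Classical.epsilon_spec (p := fun p => p ∈ X ∧ ∀ y ∈ X, ‖u - p‖ ≤ ‖u - y‖)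
    ⟨v, hv, fun y hy => ?_⟩
  rw [h]
  exact ciInf_le ⟨0, by rintro _ ⟨w, rfl⟩; exact norm_nonneg _⟩ (⟨y, hy⟩ : X)

theorem inner_sub_eucProj_le (hX : Convex ℝ X) (hc : IsClosed X) (u : Euc n)
    {w : Euc n} (hw : w ∈ X) : inner ℝ (u - eucProj X u) (w - eucProj X u) ≤ 0 := by
  obtain ⟨h1, h2⟩ := eucProj_spec hX hc ⟨w, hw⟩ u
  refine (norm_eq_iInf_iff_real_inner_le_zero hX h1).mp ?_ w hw
  have : Nonempty X := ⟨⟨w, hw⟩⟩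
  exact le_antisymm (le_ciInf fun y => h2 y y.2)
    (ciInf_le ⟨0, by rintro _ ⟨w, rfl⟩; exact norm_nonneg _⟩ (⟨_, h1⟩ : X))

/-- Adding the variational inequalities of the two projections gives `‖a - b‖² ≤ ⟪u - w, a - b⟫`;
Cauchy–Schwarz finishes. -/
theorem norm_eucProj_sub_eucProj_le (hX : Convex ℝ X) (hc : IsClosed X) (hne : X.Nonempty)
    (u w : Euc n) : ‖eucProj X u - eucProj X w‖ ≤ ‖u - w‖ := by
  have h1 := inner_sub_eucProj_le hX hc u (eucProj_spec hX hc hne w).1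
  have h2 := inner_sub_eucProj_le hX hc w (eucProj_spec hX hc hne u).1
  set a := eucProj X u
  set b := eucProj X w
  have h3 : ‖a - b‖ ^ 2 ≤ inner ℝ (u - w) (a - b) := by
    rw [← real_inner_self_eq_norm_sq]
    have : inner ℝ (u - w) (a - b) - inner ℝ (a - b) (a - b) =
        -inner ℝ (u - a) (b - a) - inner ℝ (w - b) (a - b) := by
      rw [← neg_sub a b, inner_neg_right, neg_neg, ← inner_sub_left, ← inner_sub_left]
      congr 1
      abel
    linarith
  have h4 := h3.trans (real_inner_le_norm _ _)
  by_contra hlt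
  push Not at hlt
  nlinarith [norm_nonneg (u - w), norm_nonneg (a - b)]

theorem continuous_eucProj (hX : Convex ℝ X) (hc : IsClosed X) (hne : X.Nonempty) :
    Continuous (eucProj X) :=
  (LipschitzWith.of_dist_le_mul (K := 1) fun u w => by
    simpa [dist_eq_norm] using norm_eucProj_sub_eucProj_le hX hc hne u w).continuous

theorem eucProj_of_mem (hX : Convex ℝ X) (hc : IsClosed X) {y : Euc n} (hy : y ∈ X) :
    eucProj X y = y := by
  have := (eucProj_spec hX hc ⟨y, hy⟩ y).2 y hy
  rw [sub_self, norm_zero, norm_le_zero_iff, sub_eq_zero] at this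
  exact this.symm

end Projection

/-! ### Averaging over an independent variable -/

section IndependentPairs

variable {Ω α β : Type*} [MeasurableSpace Ω] [MeasurableSpace α] [MeasurableSpace β]
  {μ : Measure Ω} [IsProbabilityMeasure μ] {U : Ω → α} {W : Ω → β} {τ : Measure β}

theorem ProbabilityTheory.IndepFun.measurePreserving_prodMk (h : IndepFun U W μ)
    (hU : Measurable U) (hW : Measurable W) (hτ : μ.map W = τ) :
    MeasurePreserving (fun ω => (U ω, W ω)) μ ((μ.map U).prod τ) := by
  refine ⟨hU.prodMk hW, ?_⟩
  rw [(indepFun_iff_map_prod_eq_prod_map_map hU.aemeasurable hW.aemeasurable).mp h, hτ]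

theorem ProbabilityTheory.IndepFun.lintegral_comp [SFinite τ] (h : IndepFun U W μ) (hU : Measurable U)
    (hW : Measurable W) (hτ : μ.map W = τ) {H : α × β → ℝ≥0∞} (hH : Measurable H) :
    ∫⁻ ω, H (U ω, W ω) ∂μ = ∫⁻ ω, ∫⁻ t, H (U ω, t) ∂τ ∂μ := by
  rw [(h.measurePreserving_prodMk hU hW hτ).lintegral_comp hH, lintegral_prod _ hH.aemeasurable,
    lintegral_map hH.lintegral_prod_right' hU]

/-- Fubini on the product of the two laws; it plays the role of conditioning on the current iterate
`U`. -/
theorem ProbabilityTheory.IndepFun.integrable_integral_comp [SFinite τ] (h : IndepFun U W μ)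
    (hU : Measurable U) (hW : Measurable W) (hτ : μ.map W = τ) {H : α × β → ℝ}
    (hH : Measurable H) (hi : Integrable (fun ω => H (U ω, W ω)) μ) :
    Integrable (fun ω => ∫ t, H (U ω, t) ∂τ) μ ∧
      ∫ ω, H (U ω, W ω) ∂μ = ∫ ω, ∫ t, H (U ω, t) ∂τ ∂μ := by
  have : IsProbabilityMeasure (μ.map U) := Measure.isProbabilityMeasure_map hU.aemeasurable
  have hmp := h.measurePreserving_prodMk hU hW hτ
  have hi' : Integrable H ((μ.map U).prod τ) :=
    (hmp.integrable_comp hH.aestronglyMeasurable).mp hi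
  refine ⟨hi'.integral_prod_left.comp_measurable hU, ?_⟩
  rw [← integral_map (φ := U) (f := fun a => ∫ t, H (a, t) ∂τ) hU.aemeasurable
    hi'.integral_prod_left.aestronglyMeasurable, ← integral_prod _ hi', ← hmp.map_eq,
    integral_map hmp.measurable.aemeasurable hH.aestronglyMeasurable]

end IndependentPairs

theorem LipschitzWith.integrable_comp_of_integrable {Ω E : Type*} [MeasurableSpace Ω]
    {μ : Measure Ω} [IsFiniteMeasure μ] [NormedAddCommGroup E] {f : E → ℝ} {C : ℝ≥0}
    (hf : LipschitzWith C f) {Y : Ω → E} (hY : Integrable Y μ) :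
    Integrable (fun ω => f (Y ω)) μ := by
  refine ((hY.norm.const_mul (C : ℝ)).add (integrable_const ‖f 0‖)).mono'
    (hf.continuous.comp_aestronglyMeasurable hY.aestronglyMeasurable) (.of_forall fun ω => ?_)
  have h1 := hf.norm_sub_le (Y ω) 0
  rw [sub_zero] at h1
  have h2 := norm_sub_norm_le (f (Y ω)) (f 0)
  simp only [Pi.add_apply]
  linarith

/-! ### Convergence of the projected method -/

namespace StochModel

variable {n : ℕ} {P : StochModel n} {L : ℝ} {X : Set (Euc n)} {x₀ xs : Euc n} {γ : ℕ → ℝ} {η : ℝ}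
  {Ω : Type*} {V : ℕ → Ω → ℝ} {Z : ℕ → Ω → Euc n} {s : ℕ → Ω → P.S}

/-- The σ-algebra generated by the draws of the first `k` iterations. -/
abbrev past (V : ℕ → Ω → ℝ) (Z : ℕ → Ω → Euc n) (s : ℕ → Ω → P.S) (k : ℕ) : MeasurableSpace Ω :=
  ⨆ j ∈ Set.Iio k, MeasurableSpace.comap (fun ω => (V j ω, Z j ω, s j ω)) inferInstance

/-- The iterate `x_k` uses only the draws with index `j < k`; the strict inequality is what makes it
independent of draw `k`. -/
theorem IsRegular.measurable_past_iterate (h : P.IsRegular L) (hX : Convex ℝ X) (hc : IsClosed X)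
    (hne : X.Nonempty) (k : ℕ) :
    Measurable[past V Z s k] (P.iterate X x₀ γ η V Z s k) := by
  induction k with
  | zero => exact @measurable_const _ _ _ (past V Z s 0) x₀
  | succ k ih =>
    have hle : past V Z s k ≤ past V Z s (k + 1) :=
      biSup_mono fun j hj => lt_trans hj (Nat.lt_succ_self k)
    have h1 : Measurable[past V Z s (k + 1)] (P.iterate X x₀ γ η V Z s k) := ih.mono hle le_rfl
    have h2 : Measurable[past V Z s (k + 1)] (fun ω => (V k ω, Z k ω, s k ω)) :=
      Measurable.of_comap_le (le_iSup₂_of_le (f := fun j (_ : j ∈ Set.Iio (k + 1)) =>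
        MeasurableSpace.comap (fun ω => (V j ω, Z j ω, s j ω)) inferInstance)
        k (Nat.lt_succ_self k) le_rfl)
    have h3 : Measurable fun q : Euc n × ℝ × Euc n × P.S =>
        eucProj X (q.1 - γ k • P.grad η q.1 q.2) :=
      (continuous_eucProj hX hc hne).measurable.comp
        (measurable_fst.sub ((h.measurable_grad η).const_smul (γ k)))
    have h4 : P.iterate X x₀ γ η V Z s (k + 1) = fun ω => eucProj X
        (P.iterate X x₀ γ η V Z s k ω -
          γ k • P.grad η (P.iterate X x₀ γ η V Z s k ω) (V k ω, Z k ω, s k ω)) :=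
      funext (P.iterate_succ k)
    rw [h4]
    have h5 := @Measurable.prodMk _ (past V Z s (k + 1)) _ _ _ _ _ _ h1 h2
    have h6 := @Measurable.comp _ _ _ (past V Z s (k + 1)) _ _ _ _ h3 h5
    exact h6

variable [MeasurableSpace Ω] {μ : Measure Ω}

theorem past_le (hS : P.IsSampling η μ V Z s) (k : ℕ) : past V Z s k ≤ ‹MeasurableSpace Ω› :=
  iSup₂_le fun j _ =>
    ((hS.meas_V j).prodMk ((hS.meas_Z j).prodMk (hS.meas_s j))).comap_le

theorem IsRegular.measurable_iterate (h : P.IsRegular L) (hX : Convex ℝ X) (hc : IsClosed X)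
    (hne : X.Nonempty) (hS : P.IsSampling η μ V Z s) (k : ℕ) :
    Measurable (P.iterate X x₀ γ η V Z s k) :=
  (h.measurable_past_iterate hX hc hne k).mono (past_le hS k) le_rfl

theorem IsRegular.indepFun_iterate (h : P.IsRegular L) (hX : Convex ℝ X) (hc : IsClosed X)
    (hne : X.Nonempty) (hS : P.IsSampling η μ V Z s) (k : ℕ) :
    IndepFun (P.iterate X x₀ γ η V Z s k) (fun ω => (V k ω, Z k ω, s k ω)) μ := by
  rw [IndepFun_iff_Indep]
  have h1 := indep_iSup_of_disjoint
    (fun j => ((hS.meas_V j).prodMk ((hS.meas_Z j).prodMk (hS.meas_s j))).comap_le)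
    ((iIndepFun_iff_iIndep _ _ _).mp hS.indep)
    (S := Set.Iio k) (T := {k}) (by simp)
  refine indep_of_indep_of_le_left (indep_of_indep_of_le_right h1 ?_)
    (h.measurable_past_iterate hX hc hne k).comap_le
  simp

/-- One step of the analysis: integrability is propagated and the expected squared distance to a
point of `X` satisfies the usual recursion. -/
theorem IsRegular.step [IsProbabilityMeasure μ] (h : P.IsRegular L) (hL : 0 ≤ L) (hn : 0 < n)
    (hX : Convex ℝ X) (hc : IsClosed X) (hxs : xs ∈ X) (hγ : ∀ k, 0 < γ k) (hη : 0 < η)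
    (hS : P.IsSampling η μ V Z s) (k : ℕ)
    (hA : Integrable (fun ω => ‖P.iterate X x₀ γ η V Z s k ω - xs‖ ^ 2) μ)
    (hf : Integrable (fun ω => P.obj (P.iterate X x₀ γ η V Z s k ω)) μ) :
    Integrable (fun ω => ‖P.iterate X x₀ γ η V Z s (k + 1) ω - xs‖ ^ 2) μ ∧
      γ k * (∫ ω, (P.obj (P.iterate X x₀ γ η V Z s k ω) - P.obj xs) ∂μ) ≤
        γ k * (L * (√n * η)) + (∫ ω, ‖P.iterate X x₀ γ η V Z s k ω - xs‖ ^ 2 ∂μ -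
          ∫ ω, ‖P.iterate X x₀ γ η V Z s (k + 1) ω - xs‖ ^ 2 ∂μ) / 2 +
          2 * L ^ 2 * n / Real.pi * γ k ^ 2 := by
  have hprob := h.isProbabilityMeasure_drawLaw η
  have hne : X.Nonempty := ⟨xs, hxs⟩
  set x := P.iterate X x₀ γ η V Z s k
  set T : Ω → ℝ × Euc n × P.S := fun ω => (V k ω, Z k ω, s k ω)
  have hxm : Measurable x := h.measurable_iterate hX hc hne hS k
  have hTm : Measurable T := (hS.meas_V k).prodMk ((hS.meas_Z k).prodMk (hS.meas_s k))
  have hind : IndepFun x T μ := h.indepFun_iterate hX hc hne hS k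
  have hlaw : μ.map T = P.drawLaw η := hS.law_eq k
  have hgm := h.measurable_grad η
  have hgm' : Measurable fun ω => P.grad η (x ω) (T ω) := hgm.comp (hxm.prodMk hTm)
  have hglint : ∫⁻ ω, ENNReal.ofReal (‖P.grad η (x ω) (T ω)‖ ^ 2) ∂μ ≤
      ENNReal.ofReal (4 * n * L ^ 2 / Real.pi) := by
    rw [hind.lintegral_comp hxm hTm hlaw
      (H := fun q => ENNReal.ofReal (‖P.grad η q.1 q.2‖ ^ 2)) (hgm.norm.pow_const 2).ennreal_ofReal]
    refine (lintegral_mono fun ω => h.lintegral_norm_grad_sq_le hη (x ω)).trans_eq ?_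
    simp
  have hgi : Integrable (fun ω => ‖P.grad η (x ω) (T ω)‖ ^ 2) μ := by
    refine ⟨(hgm'.norm.pow_const 2).aestronglyMeasurable, ?_⟩
    rw [hasFiniteIntegral_iff_ofReal (.of_forall fun _ => sq_nonneg _)]
    exact hglint.trans_lt ENNReal.ofReal_lt_top
  have hgint : ∫ ω, ‖P.grad η (x ω) (T ω)‖ ^ 2 ∂μ ≤ 4 * n * L ^ 2 / Real.pi := by
    rw [← ofReal_integral_eq_lintegral_ofReal hgi (.of_forall fun _ => sq_nonneg _)] at hglint
    exact (ENNReal.ofReal_le_ofReal_iff (by positivity)).mp hglint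
  have hHm : Measurable fun q : Euc n × ℝ × Euc n × P.S =>
      inner ℝ (P.grad η q.1 q.2) (q.1 - xs) :=
    Measurable.inner hgm (measurable_fst.sub_const xs)
  -- The inner product is dominated by the sum of the two squared norms.
  have hii : Integrable (fun ω => inner ℝ (P.grad η (x ω) (T ω)) (x ω - xs)) μ := by
    refine (hgi.add hA).mono' (hHm.comp (hxm.prodMk hTm)).aestronglyMeasurable
      (.of_forall fun ω => ?_)
    refine (norm_inner_le_norm _ _).trans ?_
    simp only [Pi.add_apply]
    nlinarith [sq_nonneg (‖P.grad η (x ω) (T ω)‖ - ‖x ω - xs‖),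
      sq_nonneg (‖P.grad η (x ω) (T ω)‖), sq_nonneg ‖x ω - xs‖]
  -- With `x` frozen, averaging over the draw makes the approximate subgradient inequality available
  -- at each `ω`.
  obtain ⟨hJi, hJ⟩ := hind.integrable_integral_comp hxm hTm hlaw hHm hii
  have hlow : ∫ ω, (P.obj (x ω) - P.obj xs) ∂μ - L * (√n * η) ≤
      ∫ ω, inner ℝ (P.grad η (x ω) (T ω)) (x ω - xs) ∂μ := by
    have hfi : Integrable (fun ω => P.obj (x ω) - P.obj xs) μ := hf.sub (integrable_const _)
    have e : ∫ ω, (P.obj (x ω) - P.obj xs - L * (√n * η)) ∂μ =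
        ∫ ω, (P.obj (x ω) - P.obj xs) ∂μ - L * (√n * η) := by
      rw [integral_sub hfi (integrable_const _), integral_const, probReal_univ, one_smul]
    rw [hJ, ← e]
    exact integral_mono (hfi.sub (integrable_const _)) hJi
      fun ω => h.sub_le_integral_inner_grad hL hn hη (x ω) xs
  -- Nonexpansiveness against `xs`, which is its own projection, followed by expansion of the
  -- square.
  have hpt : ∀ ω, ‖P.iterate X x₀ γ η V Z s (k + 1) ω - xs‖ ^ 2 ≤
      ‖x ω - xs‖ ^ 2 - 2 * γ k * inner ℝ (P.grad η (x ω) (T ω)) (x ω - xs) +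
        γ k ^ 2 * ‖P.grad η (x ω) (T ω)‖ ^ 2 := fun ω => by
    have h1 := norm_eucProj_sub_eucProj_le hX hc hne (x ω - γ k • P.grad η (x ω) (T ω)) xs
    rw [eucProj_of_mem hX hc hxs] at h1
    have h2 := pow_le_pow_left₀ (norm_nonneg _) h1 2
    rw [iterate_succ]
    refine h2.trans_eq ?_
    rw [show x ω - γ k • P.grad η (x ω) (T ω) - xs =
      (x ω - xs) - γ k • P.grad η (x ω) (T ω) by abel, norm_sub_sq_real, inner_smul_right,
      norm_smul, mul_pow, Real.norm_eq_abs, sq_abs, real_inner_comm]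
    ring
  have hRi : Integrable (fun ω => ‖x ω - xs‖ ^ 2 -
      2 * γ k * inner ℝ (P.grad η (x ω) (T ω)) (x ω - xs) +
        γ k ^ 2 * ‖P.grad η (x ω) (T ω)‖ ^ 2) μ :=
    (hA.sub (hii.const_mul _)).add (hgi.const_mul _)
  have hA' : Integrable (fun ω => ‖P.iterate X x₀ γ η V Z s (k + 1) ω - xs‖ ^ 2) μ := by
    refine hRi.mono' (((h.measurable_iterate hX hc hne hS (k + 1)).sub_const
      xs).norm.pow_const 2).aestronglyMeasurable (.of_forall fun ω => ?_)
    rw [Real.norm_of_nonneg (sq_nonneg _)]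
    exact hpt ω
  refine ⟨hA', ?_⟩
  have hint := integral_mono hA' hRi hpt
  have hBi : Integrable (fun ω => ‖x ω - xs‖ ^ 2 -
      2 * γ k * inner ℝ (P.grad η (x ω) (T ω)) (x ω - xs)) μ := hA.sub (hii.const_mul _)
  rw [integral_add hBi (hgi.const_mul _), integral_sub hA (hii.const_mul _),
    integral_const_mul, integral_const_mul] at hint
  have h5 := mul_le_mul_of_nonneg_left hlow (hγ k).le
  have h6 := mul_le_mul_of_nonneg_left hgint (sq_nonneg (γ k))
  have h7 : γ k ^ 2 * (4 * n * L ^ 2 / Real.pi) = 2 * (2 * L ^ 2 * n / Real.pi * γ k ^ 2) := by ring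
  linarith

theorem integrable_of_integrable_norm_sub_sq [IsFiniteMeasure μ] {Y : Ω → Euc n}
    (hY : Measurable Y) (h : Integrable (fun ω => ‖Y ω - xs‖ ^ 2) μ) : Integrable Y μ := by
  have h1 : MemLp (fun ω => Y ω - xs) 2 μ :=
    (memLp_two_iff_integrable_sq_norm (hY.sub_const xs).aestronglyMeasurable).mpr h
  refine ((h1.integrable one_le_two).add (integrable_const xs)).congr (.of_forall fun ω => ?_)
  simp

/-- Square integrability of `x_k - xs` makes `x_k`, hence the Lipschitz objective at `x_k`,
integrable, as the next step requires. -/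
theorem IsRegular.integrable_norm_iterate_sub_sq [IsProbabilityMeasure μ] (h : P.IsRegular L)
    (hL : 0 ≤ L) (hn : 0 < n) (hX : Convex ℝ X) (hc : IsClosed X) (hxs : xs ∈ X)
    (hγ : ∀ k, 0 < γ k) (hη : 0 < η) (hS : P.IsSampling η μ V Z s) (k : ℕ) :
    Integrable (fun ω => ‖P.iterate X x₀ γ η V Z s k ω - xs‖ ^ 2) μ := by
  induction k with
  | zero => exact integrable_const (‖x₀ - xs‖ ^ 2)
  | succ k ih =>
    refine (h.step hL hn hX hc hxs hγ hη hS k ih ?_).1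
    exact (h.lipschitzWith_obj hL).integrable_comp_of_integrable
      (integrable_of_integrable_norm_sub_sq (h.measurable_iterate hX hc ⟨xs, hxs⟩ hS k) ih)

theorem IsRegular.integrable_iterate [IsProbabilityMeasure μ] (h : P.IsRegular L)
    (hL : 0 ≤ L) (hn : 0 < n) (hX : Convex ℝ X) (hc : IsClosed X) (hxs : xs ∈ X)
    (hγ : ∀ k, 0 < γ k) (hη : 0 < η) (hS : P.IsSampling η μ V Z s) (k : ℕ) :
    Integrable (P.iterate X x₀ γ η V Z s k) μ :=
  integrable_of_integrable_norm_sub_sq (h.measurable_iterate hX hc ⟨xs, hxs⟩ hS k)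
    (h.integrable_norm_iterate_sub_sq hL hn hX hc hxs hγ hη hS k)

theorem IsRegular.sum_mul_integral_le [IsProbabilityMeasure μ] (h : P.IsRegular L)
    (hL : 0 ≤ L) (hn : 0 < n) (hX : Convex ℝ X) (hc : IsClosed X) (hxs : xs ∈ X)
    (hγ : ∀ k, 0 < γ k) (hη : 0 < η) (hS : P.IsSampling η μ V Z s) (K : ℕ) :
    ∑ k ∈ Finset.range K,
        γ k * (∫ ω, (P.obj (P.iterate X x₀ γ η V Z s k ω) - P.obj xs) ∂μ) ≤
      (∑ k ∈ Finset.range K, γ k) * (L * (√n * η)) + (‖x₀ - xs‖ ^ 2 / 2 +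
        2 * L ^ 2 * n / Real.pi * ∑ k ∈ Finset.range K, γ k ^ 2) := by
  have hA := h.integrable_norm_iterate_sub_sq (x₀ := x₀) hL hn hX hc hxs hγ hη hS
  have hf := fun k => (h.lipschitzWith_obj hL).integrable_comp_of_integrable
    (h.integrable_iterate (x₀ := x₀) hL hn hX hc hxs hγ hη hS k)
  have key := Finset.sum_le_sum fun k (_ : k ∈ Finset.range K) =>
    (h.step hL hn hX hc hxs hγ hη hS k (hA k) (hf k)).2
  refine key.trans ?_
  rw [Finset.sum_add_distrib, Finset.sum_add_distrib, ← Finset.sum_mul, ← Finset.sum_div,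
    Finset.sum_range_sub', ← Finset.mul_sum]
  have h0 : ∫ ω, ‖P.iterate X x₀ γ η V Z s 0 ω - xs‖ ^ 2 ∂μ = ‖x₀ - xs‖ ^ 2 := by
    change ∫ _, ‖x₀ - xs‖ ^ 2 ∂μ = _
    simp
  -- The sum telescopes; the final squared distance is nonnegative and is dropped.
  have hK : 0 ≤ ∫ ω, ‖P.iterate X x₀ γ η V Z s K ω - xs‖ ^ 2 ∂μ :=
    integral_nonneg fun _ => sq_nonneg _
  rw [h0]
  linarith

/-- The convergence guarantee of the method with constant smoothing parameter. -/
theorem IsRegular.error_bound [IsProbabilityMeasure μ] (h : P.IsRegular L)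
    (hL : 0 ≤ L) (hn : 0 < n) (hX : Convex ℝ X) (hc : IsClosed X) (hxs : xs ∈ X)
    (hγ : ∀ k, 0 < γ k) (hη : 0 < η) (hS : P.IsSampling η μ V Z s) {K : ℕ} (hK : 0 < K) :
    Integrable (fun ω => P.obj (P.average X x₀ γ η V Z s K ω)) μ ∧
      (∀ k, Integrable (fun ω => P.obj (P.iterate X x₀ γ η V Z s k ω)) μ) ∧
      (∫ ω, P.obj (P.average X x₀ γ η V Z s K ω) ∂μ) - P.obj xs ≤
        1 / (∑ k ∈ Finset.range K, γ k) *
          ∑ k ∈ Finset.range K,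
            ∫ ω, γ k * (P.obj (P.iterate X x₀ γ η V Z s k ω) - P.obj xs) ∂μ ∧
      1 / (∑ k ∈ Finset.range K, γ k) *
          ∑ k ∈ Finset.range K,
            ∫ ω, γ k * (P.obj (P.iterate X x₀ γ η V Z s k ω) - P.obj xs) ∂μ ≤
        L * √((n : ℝ) + 1) * η +
          1 / (∑ k ∈ Finset.range K, γ k) *
            (‖x₀ - xs‖ ^ 2 / 2 +
              2 * L ^ 2 * (n : ℝ) / Real.pi * ∑ k ∈ Finset.range K, γ k ^ 2) := by
  have hlip := h.lipschitzWith_obj hL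
  have hxi := h.integrable_iterate (x₀ := x₀) hL hn hX hc hxs hγ hη hS
  have hf := fun k => hlip.integrable_comp_of_integrable (hxi k)
  have hS0 : 0 < ∑ k ∈ Finset.range K, γ k :=
    Finset.sum_pos (fun k _ => hγ k) (Finset.nonempty_range_iff.mpr hK.ne')
  set Sg := ∑ k ∈ Finset.range K, γ k with hSg
  have havg : Integrable (P.average X x₀ γ η V Z s K) μ := by
    have : Integrable (fun ω => Sg⁻¹ •
        ∑ k ∈ Finset.range K, γ k • P.iterate X x₀ γ η V Z s k ω) μ :=
      (integrable_finsetSum _ fun k _ => (hxi k).smul (γ k)).smul Sg⁻¹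
    exact this
  have hfavg := hlip.integrable_comp_of_integrable havg
  refine ⟨hfavg, hf, ?_, ?_⟩
  · have hpt : ∀ ω, P.obj (P.average X x₀ γ η V Z s K ω) - P.obj xs ≤
        Sg⁻¹ * ∑ k ∈ Finset.range K,
          γ k * (P.obj (P.iterate X x₀ γ η V Z s k ω) - P.obj xs) := fun ω => by
      have hw : ∑ k ∈ Finset.range K, Sg⁻¹ * γ k = 1 := by
        rw [← Finset.mul_sum, inv_mul_cancel₀ hS0.ne']
      have h1 := h.convex.map_sum_le (t := Finset.range K) (w := fun k => Sg⁻¹ * γ k)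
        (p := fun k => P.iterate X x₀ γ η V Z s k ω)
        (fun k _ => mul_nonneg (inv_nonneg.mpr hS0.le) (hγ k).le) hw (fun _ _ => Set.mem_univ _)
      have h2 : P.average X x₀ γ η V Z s K ω =
          ∑ k ∈ Finset.range K, (Sg⁻¹ * γ k) • P.iterate X x₀ γ η V Z s k ω := by
        simp only [average, Finset.smul_sum, smul_smul, hSg]
      rw [h2]
      refine (sub_le_sub_right h1 _).trans_eq ?_
      simp only [mul_sub, Finset.sum_sub_distrib, Finset.mul_sum, smul_eq_mul, mul_assoc]
      rw [sub_right_inj]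
      simp only [← mul_assoc]
      rw [← Finset.sum_mul, hw, one_mul]
    have hi : ∀ k ∈ Finset.range K, Integrable
        (fun ω => γ k * (P.obj (P.iterate X x₀ γ η V Z s k ω) - P.obj xs)) μ :=
      fun k _ => ((hf k).sub (integrable_const _)).const_mul _
    have := integral_mono (hfavg.sub (integrable_const _))
      ((integrable_finsetSum _ hi).const_mul Sg⁻¹) hpt
    simp only [Pi.sub_apply] at this
    rw [integral_const_mul, integral_finsetSum _ hi, integral_sub hfavg (integrable_const _),
      integral_const, probReal_univ, one_smul] at this
    rwa [one_div]
  · simp_rw [integral_const_mul]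
    have h1 := h.sum_mul_integral_le (x₀ := x₀) hL hn hX hc hxs hγ hη hS K
    -- The argument yields the bias `L√n η`, slightly better than the stated `√(n + 1)`.
    have h2 : √(n : ℝ) ≤ √((n : ℝ) + 1) := Real.sqrt_le_sqrt (by linarith)
    calc _ ≤ 1 / Sg * (Sg * (L * (√n * η)) + (‖x₀ - xs‖ ^ 2 / 2 +
          2 * L ^ 2 * n / Real.pi * ∑ k ∈ Finset.range K, γ k ^ 2)) := by gcongr
      _ = L * √n * η + 1 / Sg * (‖x₀ - xs‖ ^ 2 / 2 +
          2 * L ^ 2 * n / Real.pi * ∑ k ∈ Finset.range K, γ k ^ 2) := by field_simp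
      _ ≤ _ := by gcongr

/-- The error bound for `γ_k = R / (L √(nK))` and `η = 1 / √(nK)`. -/
theorem IsRegular.error_bound_of_fixed_horizon [IsProbabilityMeasure μ] (h : P.IsRegular L)
    (hL : 0 < L) (hn : 0 < n) (hX : Convex ℝ X) (hc : IsClosed X) (hxs : xs ∈ X)
    {R a₀ : ℝ} (hR : 0 < R) (ha₀ : ‖x₀ - xs‖ ≤ a₀) {K : ℕ} (hK : 0 < K)
    (hγ : ∀ k, γ k = R / (L * √((n : ℝ) * (K : ℝ)))) (hη : η = 1 / √((n : ℝ) * (K : ℝ)))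
    (hS : P.IsSampling η μ V Z s) :
    Integrable (fun ω => P.obj (P.average X x₀ γ η V Z s K ω)) μ ∧
      (∫ ω, P.obj (P.average X x₀ γ η V Z s K ω) ∂μ) - P.obj xs ≤
        (L * √2 + a₀ ^ 2 * L / (2 * R) + 2 * R * L / Real.pi) * √(n / K) := by
  have hn' : (1 : ℝ) ≤ n := by exact_mod_cast hn
  have hK' : (0 : ℝ) < K := by exact_mod_cast hK
  have hq : 0 < √((n : ℝ) * (K : ℝ)) := by positivity
  obtain ⟨h1, -, h2, h3⟩ := h.error_bound (x₀ := x₀) (γ := γ) hL.le hn hX hc hxs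
    (fun k => by rw [hγ k]; positivity) (by rw [hη]; positivity) hS hK
  refine ⟨h1, (h2.trans h3).trans ?_⟩
  simp only [hγ, Finset.sum_const, Finset.card_range, nsmul_eq_mul]
  rw [hη]
  have hsn : 1 ≤ √(n : ℝ) := Real.one_le_sqrt.mpr hn'
  have hsK : 0 < √(K : ℝ) := Real.sqrt_pos.mpr hK'
  have en : √(n : ℝ) ^ 2 = n := Real.sq_sqrt (by linarith)
  have eK : √(K : ℝ) ^ 2 = K := Real.sq_sqrt hK'.le
  rw [Real.sqrt_mul (by linarith) (K : ℝ), Real.sqrt_div (by linarith) (K : ℝ)]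
  -- As `η = 1/√(nK)`, the bias is at most `L√2/√K`; the factor `√n ≥ 1` is inserted to match the
  -- other terms.
  have t1 : L * √((n : ℝ) + 1) * (1 / (√n * √K)) ≤ L * √2 * (√n / √K) := by
    have : √((n : ℝ) + 1) ≤ √2 * √n := by
      rw [← Real.sqrt_mul zero_le_two]
      exact Real.sqrt_le_sqrt (by linarith)
    have h4 : √((n : ℝ) + 1) * (1 / (√n * √K)) ≤ √2 * (√n / √K) := by
      calc √((n : ℝ) + 1) * (1 / (√n * √K)) ≤ √2 * √n * (1 / (√n * √K)) := by gcongr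
        _ = √2 * (1 / √K) := by field_simp
        _ ≤ √2 * (√n / √K) := by gcongr
    calc _ = L * (√((n : ℝ) + 1) * (1 / (√n * √K))) := by ring
      _ ≤ L * (√2 * (√n / √K)) := by gcongr
      _ = _ := by ring
  have t2 : 1 / (K * (R / (L * (√n * √K)))) * (‖x₀ - xs‖ ^ 2 / 2 +
      2 * L ^ 2 * n / Real.pi * (K * (R / (L * (√n * √K))) ^ 2)) ≤
      (a₀ ^ 2 * L / (2 * R) + 2 * R * L / Real.pi) * (√n / √K) := by
    -- This step size makes the second-moment term a constant, so the rate `√(n/K)` comes from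
    -- `1/S_K` alone.
    have e1 : 2 * L ^ 2 * n / Real.pi * (K * (R / (L * (√n * √K))) ^ 2) = 2 * R ^ 2 / Real.pi := by
      rw [div_pow, mul_pow, mul_pow, en, eK]
      have : (n : ℝ) ≠ 0 := by linarith
      field_simp
    have e2 : 1 / (K * (R / (L * (√n * √K)))) = L / R * (√n / √K) := by
      nth_rewrite 1 [← eK]
      field_simp
    have h5 : ‖x₀ - xs‖ ^ 2 ≤ a₀ ^ 2 := pow_le_pow_left₀ (norm_nonneg _) ha₀ 2
    rw [e1, e2]
    calc _ ≤ L / R * (√n / √K) * (a₀ ^ 2 / 2 + 2 * R ^ 2 / Real.pi) := by gcongr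
      _ = _ := by field_simp
  linarith

end StochModel

/-! ### The error bound and the complexity estimates -/

theorem corollary4p3 (L₀ : ℝ) (hL₀ : 0 < L₀) :
    -- (i) the error bound for a constant smoothing parameter
    (∀ (n : ℕ) (_ : 0 < n) (P : StochModel n) (_ : Admissible L₀ P)
      (X : Set (Euc n)) (_ : Convex ℝ X) (_ : IsClosed X)
      (x₀ : Euc n) (_ : x₀ ∈ X) (xs : Euc n) (_ : xs ∈ X) (_ : IsMinOn P.obj X xs)
      (γ : ℕ → ℝ) (_ : ∀ k, 0 < γ k) (η : ℝ) (_ : 0 < η)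
      (Ω : Type u) [MeasurableSpace Ω] (μ : Measure Ω) [IsProbabilityMeasure μ]
      (V : ℕ → Ω → ℝ) (Z : ℕ → Ω → Euc n) (s : ℕ → Ω → P.S) (_ : P.IsSampling η μ V Z s)
      (K : ℕ) (_ : 0 < K),
      Integrable (fun ω => P.obj (P.average X x₀ γ η V Z s K ω)) μ ∧
      (∀ k, Integrable (fun ω => P.obj (P.iterate X x₀ γ η V Z s k ω)) μ) ∧
      (∫ ω, P.obj (P.average X x₀ γ η V Z s K ω) ∂μ) - P.obj xs ≤
        1 / (∑ k ∈ Finset.range K, γ k) *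
          ∑ k ∈ Finset.range K,
            ∫ ω, γ k * (P.obj (P.iterate X x₀ γ η V Z s k ω) - P.obj xs) ∂μ ∧
      1 / (∑ k ∈ Finset.range K, γ k) *
          ∑ k ∈ Finset.range K,
            ∫ ω, γ k * (P.obj (P.iterate X x₀ γ η V Z s k ω) - P.obj xs) ∂μ ≤
        L₀ * √((n : ℝ) + 1) * η +
          1 / (∑ k ∈ Finset.range K, γ k) *
            (‖x₀ - xs‖ ^ 2 / 2 +
              2 * L₀ ^ 2 * (n : ℝ) / Real.pi * ∑ k ∈ Finset.range K, γ k ^ 2)) ∧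
    -- (ii) iteration and sample complexity; the constant `C` depends on `L₀`, `R`, `a₀` only
    (∀ (R : ℝ) (_ : 0 < R) (a₀ : ℝ) (_ : 0 ≤ a₀), ∃ C : ℝ, 0 < C ∧
      ∀ (n : ℕ) (_ : 0 < n) (P : StochModel n) (_ : Admissible L₀ P)
        (X : Set (Euc n)) (_ : Convex ℝ X) (_ : IsClosed X)
        (x₀ : Euc n) (_ : x₀ ∈ X) (xs : Euc n) (_ : xs ∈ X) (_ : IsMinOn P.obj X xs)
        (_ : ‖x₀ - xs‖ ≤ a₀),
        -- for every `ε > 0`, every number `K ≥ C n ε⁻²` of iterations suffices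
        (∀ (ε : ℝ) (_ : 0 < ε) (K : ℕ) (_ : 0 < K) (_ : C * (n : ℝ) / ε ^ 2 ≤ (K : ℝ))
          (γ : ℕ → ℝ) (_ : ∀ k, γ k = R / (L₀ * √((n : ℝ) * (K : ℝ))))
          (η : ℝ) (_ : η = 1 / √((n : ℝ) * (K : ℝ)))
          (Ω : Type u) [MeasurableSpace Ω] (μ : Measure Ω) [IsProbabilityMeasure μ]
          (V : ℕ → Ω → ℝ) (Z : ℕ → Ω → Euc n) (s : ℕ → Ω → P.S)
          (_ : P.IsSampling η μ V Z s),
          Integrable (fun ω => P.obj (P.average X x₀ γ η V Z s K ω)) μ ∧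
          (∫ ω, P.obj (P.average X x₀ γ η V Z s K ω) ∂μ) - P.obj xs ≤ ε) ∧
        -- for `0 < ε ≤ 1`, some number `K ≤ C n ε⁻²` of iterations, which make at most
        -- `C n² ε⁻²` function evaluations, suffices
        (∀ (ε : ℝ) (_ : 0 < ε) (_ : ε ≤ 1), ∃ K : ℕ, 0 < K ∧ (K : ℝ) ≤ C * (n : ℝ) / ε ^ 2 ∧
          ∀ (γ : ℕ → ℝ) (_ : ∀ k, γ k = R / (L₀ * √((n : ℝ) * (K : ℝ))))
            (η : ℝ) (_ : η = 1 / √((n : ℝ) * (K : ℝ)))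
            (Ω : Type u) [MeasurableSpace Ω] (μ : Measure Ω) [IsProbabilityMeasure μ]
            (V : ℕ → Ω → ℝ) (Z : ℕ → Ω → Euc n) (s : ℕ → Ω → P.S)
            (_ : P.IsSampling η μ V Z s),
            (∀ ω, (P.evalCount X x₀ γ η V Z s K ω : ℝ) ≤ C * (n : ℝ) ^ 2 / ε ^ 2) ∧
            Integrable (fun ω => P.obj (P.average X x₀ γ η V Z s K ω)) μ ∧
            (∫ ω, P.obj (P.average X x₀ γ η V Z s K ω) ∂μ) - P.obj xs ≤ ε)) := by
  refine ⟨?_, ?_⟩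
  · intro n hn P hP X hX hc x₀ _ xs hxs _ γ hγ η hη Ω _ μ _ V Z s hS K hK
    exact hP.isRegular.error_bound hL₀.le hn hX hc hxs hγ hη hS hK
  · intro R hR a₀ _
    set B := L₀ * √2 + a₀ ^ 2 * L₀ / (2 * R) + 2 * R * L₀ / Real.pi
    have hB0 : 0 < B := by positivity
    -- Sufficiency needs `K ≥ B²n/ε²`; the `+ 1` absorbs rounding up, because `n/ε² ≥ 1` for `ε ≤
    -- 1`, and the `2` absorbs the `2n` evaluations per iteration.
    refine ⟨2 * (B ^ 2 + 1), by positivity, ?_⟩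
    intro n hn P hP X hX hc x₀ _ xs hxs _ hle
    have hn' : (1 : ℝ) ≤ n := by exact_mod_cast hn
    have suff : ∀ ε : ℝ, 0 < ε → ∀ K : ℕ, 0 < K → B ^ 2 * n / ε ^ 2 ≤ K →
        B * √((n : ℝ) / K) ≤ ε := fun ε hε K hK h => by
      have hK' : (0 : ℝ) < K := by exact_mod_cast hK
      rw [div_le_iff₀ (by positivity)] at h
      refine (sq_le_sq₀ (by positivity) hε.le).mp ?_
      rw [mul_pow, Real.sq_sqrt (by positivity), ← mul_div_assoc, div_le_iff₀ hK']
      linarith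
    refine ⟨?_, ?_⟩
    · intro ε hε K hK hCK γ hγ η hη Ω _ μ _ V Z s hS
      obtain ⟨h1, h2⟩ := hP.isRegular.error_bound_of_fixed_horizon hL₀ hn hX hc hxs hR hle hK
        hγ hη hS
      refine ⟨h1, h2.trans (suff ε hε K hK (le_trans ?_ hCK))⟩
      gcongr
      linarith [sq_nonneg B]
    · intro ε hε hε1
      have hr : 1 ≤ (n : ℝ) / ε ^ 2 := by
        rw [one_le_div (by positivity)]
        exact (pow_le_one₀ hε.le hε1).trans hn'
      have hr0 : 0 < B ^ 2 * n / ε ^ 2 := by positivity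
      have hK : 0 < ⌈B ^ 2 * n / ε ^ 2⌉₊ := Nat.ceil_pos.mpr hr0
      have hKle : (⌈B ^ 2 * n / ε ^ 2⌉₊ : ℝ) ≤ (B ^ 2 + 1) * ((n : ℝ) / ε ^ 2) := by
        refine (Nat.ceil_lt_add_one hr0.le).le.trans ?_
        rw [mul_div_assoc]
        linarith
      refine ⟨⌈B ^ 2 * n / ε ^ 2⌉₊, hK, hKle.trans ?_, ?_⟩
      · rw [mul_div_assoc]
        have : 0 ≤ (B ^ 2 + 1) * ((n : ℝ) / ε ^ 2) := by positivity
        linarith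
      · intro γ hγ η hη Ω _ μ _ V Z s hS
        obtain ⟨h1, h2⟩ := hP.isRegular.error_bound_of_fixed_horizon hL₀ hn hX hc hxs hR hle hK
          hγ hη hS
        refine ⟨fun ω => ?_, h1, h2.trans (suff ε hε _ hK (Nat.le_ceil _))⟩
        rw [StochModel.evalCount, StochModel.run_evals]
        push_cast
        calc 2 * (n : ℝ) * ⌈B ^ 2 * n / ε ^ 2⌉₊ ≤
            2 * (n : ℝ) * ((B ^ 2 + 1) * ((n : ℝ) / ε ^ 2)) := by gcongr
          _ = _ := by ring
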